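/- Write $\mathbb N=\{1,2,\dots\}$, and let $n,d\in\mathbb N$. *Order.* For a tuple $x\in\mathbb N^m$ let $\max x$ be its largest entry, let $\tilde x\in\mathbb N^m$ be obtained from $x$ by replacing every entry smaller than $\max x$ by $1$, and let $x_*$ be obtained from $x$ by dropping all entries equal to $\max x$. Let $\prec_R$ be the right-to-left strict lexicographic order: $x\prec_R y$ if for some $i$ one has $x_i<y_i$ and $x_j=y_j$ for all $j>i$. The Ahlswede–Cai order $\prec$ on $\mathbb N^m$ is the strict total order defined recursively in $m$ as follows: for $x\ne y$, $x\prec y$ if either $\max x<\max y$; or $\max x=\max y$ and $\tilde x\prec_R\tilde y$; or $\max x=\max y>2$, $\tilde x=\tilde y$ and $x_*\prec y_*$. *Daisies.* For a nonempty $S\subset\{1,\dots,d\}$, a tuple $(q_i)_{i\in S}$ of positive integers is called DO1 if it is nonincreasing in $i$ and its first and last entries differ by at most $1$. Its value-change position is $\min S$ if the tuple is constant, and otherwise the smallest $j\in S$, $j>\min S$, such that $q_j<q_{\pi(j)}$, where $\pi(j)=\max\{i\in S:i<j\}$. A set $Q\subset\mathbb Z^d$ is a $d$-dimensional daisy if there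 are $h\in\{0,\dots,d-1\}$ and, for $k=0,\dots,h$, DO1 tuples $(q^{(d-k)}_j)_{j\in S_k}$ such that $S_0=\{1,\dots,d\}$; $S_k=S_{k-1}\setminus\{s_k\}$ for $1\le k\le h$, where $s_k$ is the value-change position of $(q^{(d-k+1)}_j)_{j\in S_{k-1}}$; for $1\le k\le h$ one has $q^{(d-k)}_i\le q^{(d-k+1)}_i$ for all $i\in S_k$, with strict inequality for at least one $i\in S_k$; and $$Q=\bigcup_{k=0}^{h}Q^{(d-k)},\qquad Q^{(d-k)}=A^{(d-k)}_1\times\dots\times A^{(d-k)}_d,$$ where $A^{(d-k)}_j=\{1,\dots,q^{(d-k)}_j\}$ if $j\in S_k$, and $A^{(d-k)}_j=\{q_j^{(d-r)}+1\}$ with $r=\max\{m\in\{0,\dots,k-1\}: j\in S_m\}$ if $j\notin S_k$. *Edge perimeter.* The edge perimeter of a finite set $C\subset\mathbb Z^d$ is the number of pairs $(x,y)\in C\times(\mathbb Z^d\setminus C)$ with $|x-y|=1$ (Euclidean norm). $C$ is an $EIP^d$ minimizer if no set $C'\subset\mathbb Z^d$ with $\#C'=\#C$ has smaller edge perimeter.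 **Theorem.** For all $n,d\in\mathbb N$ there exists a unique $d$-dimensional daisy $Q\subset\mathbb Z^d$ with $\#Q=n$. Moreover, $Q$ coincides with the set of the first $n$ elements of $\mathbb N^d$ with respect to the order $\prec$, and $Q$ is an $EIP^d$ minimizer. -/

import Mathlib

/-! Throughout, `{1, …, d}` is modelled by `Fin d`, and the positive integer tuples
`ℕ^d = {1, 2, …}^d` by the functions `Fin d → ℕ` all of whose values are at least `1`. -/

/-- `x ∈ {1, 2, …}^d`. -/
def IsPosTuple {d : ℕ} (x : Fin d → ℕ) : Prop :=
  ∀ i, 1 ≤ x i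

/-- The inclusion of natural tuples into the lattice `ℤ^d`. -/
def toLattice {d : ℕ} (x : Fin d → ℕ) : Fin d → ℤ :=
  fun i => (x i : ℤ)

/-! ### The order on positive tuples

The order is recursive in the dimension, through tuples from which some entries are dropped.
A tuple with dropped entries is described by the finset `S` of remaining indices: it is
`(x i)_{i ∈ S}`, read in increasing order of `i`, a tuple of dimension `#S`. -/

/-- `max x` for the tuple `(x i)_{i ∈ S}`. -/
def tupleMax {d : ℕ} (S : Finset (Fin d)) (x : Fin d → ℕ) : ℕ :=
  S.sup x

/-- `x̃` for the tuple `(x i)_{i ∈ S}`: entries below the maximum are replaced by `1`. -/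
def tupleTilde {d : ℕ} (S : Finset (Fin d)) (x : Fin d → ℕ) : Fin d → ℕ :=
  fun i => if x i < tupleMax S x then 1 else x i

/-- The right-to-left strict lexicographic order on tuples indexed by `S`. -/
def RightLex {d : ℕ} (S : Finset (Fin d)) (x y : Fin d → ℕ) : Prop :=
  ∃ i ∈ S, (∀ j ∈ S, i < j → x j = y j) ∧ x i < y i

/-- `PrecOn x y S` is the relation `≺` between the tuples `(x i)_{i ∈ S}` and `(y i)_{i ∈ S}`.
In the third instance `x` and `y` attain the common maximum at the same indices, and `x_*`, `y_*`
are the tuples indexed by the remaining ones. -/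
inductive PrecOn {d : ℕ} (x y : Fin d → ℕ) : Finset (Fin d) → Prop
  | max_lt (S : Finset (Fin d)) (hmax : tupleMax S x < tupleMax S y) : PrecOn x y S
  | tilde_lt (S : Finset (Fin d)) (hmax : tupleMax S x = tupleMax S y)
      (hlex : RightLex S (tupleTilde S x) (tupleTilde S y)) : PrecOn x y S
  | star_lt (S : Finset (Fin d)) (hmax : tupleMax S x = tupleMax S y)
      (htwo : 2 < tupleMax S x)
      (htilde : ∀ i ∈ S, tupleTilde S x i = tupleTilde S y i)
      (hstar : PrecOn x y (S.filter fun i => x i < tupleMax S x)) : PrecOn x y S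

/-- The order `≺` on `{1, 2, …}^d`. -/
def Prec {d : ℕ} (x y : Fin d → ℕ) : Prop :=
  PrecOn x y Finset.univ

/-- `F` is the string of the first `n` elements of `{1, 2, …}^d` with respect to `≺`: it consists
of `n` positive tuples, each of which precedes every positive tuple outside `F`. -/
def IsFirstString {d : ℕ} (n : ℕ) (F : Set (Fin d → ℕ)) : Prop :=
  (∀ x ∈ F, IsPosTuple x) ∧ F.encard = n ∧
    ∀ x ∈ F, ∀ y, IsPosTuple y → y ∉ F → Prec x y

/-! ### The edge-isoperimetric problem -/

/-- The edge boundary: ordered pairs `(x, y)` at Euclidean distance one, `x ∈ C`, `y ∉ C`. -/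
def edgeBoundary {d : ℕ} (C : Set (Fin d → ℤ)) : Set ((Fin d → ℤ) × (Fin d → ℤ)) :=
  {p | ∑ i, (p.1 i - p.2 i) ^ 2 = 1 ∧ p.1 ∈ C ∧ p.2 ∉ C}

/-- The edge perimeter. -/
noncomputable def edgePerimeter {d : ℕ} (C : Set (Fin d → ℤ)) : ℕ∞ :=
  (edgeBoundary C).encard

/-- A finite set is an edge-perimeter minimizer if its edge perimeter is the minimum over all
sets of the same cardinality. -/
def IsEIPMinimizer {d : ℕ} (C : Set (Fin d → ℤ)) : Prop :=
  C.Finite ∧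
    IsLeast {p : ℕ∞ | ∃ C' : Set (Fin d → ℤ), C'.encard = C.encard ∧ edgePerimeter C' = p}
      (edgePerimeter C)

/-! ### Daisies -/

/-- `DO1`-tuples indexed by `S`: positive, nonincreasing, with oscillation at most one. -/
def IsDO1On {d : ℕ} (S : Finset (Fin d)) (q : Fin d → ℕ) : Prop :=
  (∀ i ∈ S, 1 ≤ q i) ∧
  (∀ i ∈ S, ∀ j ∈ S, i < j → q j ≤ q i) ∧
  (∀ J₁ ∈ S, ∀ J₂ ∈ S, (∀ i ∈ S, J₁ ≤ i) → (∀ i ∈ S, i ≤ J₂) →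
    q J₁ = q J₂ ∨ q J₁ = q J₂ + 1)

/-- `i = π(j)`, the predecessor of `j` in `S`. -/
def IsPredIn {d : ℕ} (S : Finset (Fin d)) (i j : Fin d) : Prop :=
  IsGreatest {l : Fin d | l ∈ S ∧ l < j} i

/-- `t` is the value-change position of the tuple `(q i)_{i ∈ S}`: the first index if the tuple is
constant, and otherwise the first index whose entry is smaller than the previous one. -/
def IsValueChange {d : ℕ} (S : Finset (Fin d)) (q : Fin d → ℕ) (t : Fin d) : Prop :=
  ((∀ i ∈ S, ∀ j ∈ S, q i = q j) ∧ IsLeast {j : Fin d | j ∈ S} t) ∨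
  ((¬ ∀ i ∈ S, ∀ j ∈ S, q i = q j) ∧
    IsLeast {j : Fin d | j ∈ S ∧ ∃ i, IsPredIn S i j ∧ q j < q i} t)

/-- `S_{d,k} = {1, …, d} \ {s_1, …, s_k}`; here `s l` stands for `s_{l+1}`. -/
def freeIndices {d : ℕ} (s : ℕ → Fin d) (k : ℕ) : Finset (Fin d) :=
  Finset.univ.filter fun j => ∀ l < k, s l ≠ j

/-- `r_{j,k} = max {m ∈ {0, …, k-1} : j ∈ S_{d,m}}` (used for `k ≥ 1`; the set contains `0`). -/
def lastFree {d : ℕ} (s : ℕ → Fin d) (j : Fin d) (k : ℕ) : ℕ :=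
  Nat.findGreatest (fun m => j ∈ freeIndices s m) (k - 1)

/-- The constraints on the data of a daisy with layers `0, …, h`: here `q k j` stands for the
coefficient `q_j^{(d-k)}` (relevant for `j ∈ S_{d,k}`), and `s k` for `s_{k+1}`. -/
structure IsDaisyData {d : ℕ} (h : ℕ) (q : ℕ → Fin d → ℕ) (s : ℕ → Fin d) : Prop where
  h_lt : h < d
  do1 : ∀ k ≤ h, IsDO1On (freeIndices s k) (q k)
  change : ∀ k < h, IsValueChange (freeIndices s k) (q k) (s k)
  le : ∀ k < h, ∀ i ∈ freeIndices s (k + 1), q (k + 1) i ≤ q k i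
  lt : ∀ k < h, ∃ i ∈ freeIndices s (k + 1), q (k + 1) i < q k i

/-- The layer `Q^{(d-k)} = A_1 × … × A_d`, where `A_j = {1, …, q_j^{(d-k)}}` for `j ∈ S_{d,k}` and
`A_j = {q_j^{(d-r)} + 1}` with `r = r_{j,k}` for the other `j`. For `k = 0` this is the perfect
daisy with coefficients `q 0`. -/
def daisyLayer {d : ℕ} (q : ℕ → Fin d → ℕ) (s : ℕ → Fin d) (k : ℕ) : Set (Fin d → ℤ) :=
  {z | ∀ j, (j ∈ freeIndices s k → 1 ≤ z j ∧ z j ≤ (q k j : ℤ)) ∧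
    (j ∉ freeIndices s k → z j = (q (lastFree s j k) j : ℤ) + 1)}

/-- `Q ⊆ ℤ^d` is a `d`-dimensional daisy. -/
def IsDaisy {d : ℕ} (Q : Set (Fin d → ℤ)) : Prop :=
  ∃ (h : ℕ) (q : ℕ → Fin d → ℕ) (s : ℕ → Fin d),
    IsDaisyData h q s ∧ Q = {z | ∃ k ≤ h, z ∈ daisyLayer q s k}

/-! Splitting the boundary pairs by direction and orientation, one sees that the edge perimeter of
a finite set is at least twice the total number of points in its `d` coordinate projections, with
equality for sets of positive tuples that are closed under lowering coordinates. So the projections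
have to be bounded below. Take a direction in which the set has the largest number `m` of slices,
and remove the slice with the fewest points: the set has at most `m ^ d` points and the slice at
most a fraction `1 / m` of them. Induction on the set and on the slice yields a lower bound
`minShadow d n`, defined by the recursion of the greedy filling of the chain of nearly cubical boxes
in which each facet is filled in the same manner.

Daisies follow this recursion and attain the bound. The largest box of a daisy is one of the nearly
cubical boxes and the rest is a daisy in the facet that enlarges it, in which the comparison of two
tuples with respect to `≺` reduces to the comparison without the maximal coordinate. So a daisy
precedes all positive tuples outside it, and as `≺` is asymmetric there is only one set of `n`
elements with this property. -/

open Finset Function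

/-! ### The chain of nearly cubical boxes -/

/-- The number of points of the `t`-th box (counted from `0`) in the chain of `D`-dimensional boxes
that starts with the unit cube and in which the sides are enlarged by one cyclically. For
`t = D * q + a` with `a < D`, this box has `a` sides `q + 2` and `D - a` sides `q + 1`. -/
def boxSize (D t : ℕ) : ℕ :=
  (t / D + 2) ^ (t % D) * (t / D + 1) ^ (D - t % D)

/-- The total number of points in the `D` coordinate projections of the box counted by
`boxSize D t`. Where one of the subtractions of `1` is truncated, the coefficient in front of that
power vanishes. -/
def boxShadow (D t : ℕ) : ℕ :=
  t % D * ((t / D + 2) ^ (t % D - 1) * (t / D + 1) ^ (D - t % D)) +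
    (D - t % D) * ((t / D + 2) ^ (t % D) * (t / D + 1) ^ (D - t % D - 1))

/-- The index, in the chain of `D`-dimensional boxes, of the facet that is added to the `t`-th
`D + 1`-dimensional box in order to get the next one. -/
def facetIndex (D t : ℕ) : ℕ :=
  t - t / (D + 1)

theorem exists_eq_mul_add (D t : ℕ) : ∃ q a, a ≤ D ∧ t = (D + 1) * q + a :=
  ⟨t / (D + 1), t % (D + 1), Nat.le_of_lt_succ (Nat.mod_lt _ D.succ_pos),
    (Nat.div_add_mod t (D + 1)).symm⟩

theorem boxSize_mul_add {D a : ℕ} (q : ℕ) (ha : a ≤ D) :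
    boxSize D (D * q + a) = (q + 2) ^ a * (q + 1) ^ (D - a) := by
  rcases Nat.eq_zero_or_pos D with rfl | hD
  · simp [boxSize, Nat.le_zero.1 ha]
  rcases ha.lt_or_eq with h | rfl
  · simp [boxSize, Nat.mul_add_div hD, Nat.div_eq_of_lt h, Nat.mod_eq_of_lt h]
  · simp [boxSize, ← Nat.mul_succ, Nat.mul_div_cancel_left _ hD]

theorem boxShadow_mul_add {D a : ℕ} (q : ℕ) (ha : a ≤ D) :
    boxShadow D (D * q + a) = a * ((q + 2) ^ (a - 1) * (q + 1) ^ (D - a)) +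
      (D - a) * ((q + 2) ^ a * (q + 1) ^ (D - a - 1)) := by
  rcases Nat.eq_zero_or_pos D with rfl | hD
  · simp [boxShadow, Nat.le_zero.1 ha]
  rcases ha.lt_or_eq with h | rfl
  · simp [boxShadow, Nat.mul_add_div hD, Nat.div_eq_of_lt h, Nat.mod_eq_of_lt h]
  · simp [boxShadow, ← Nat.mul_succ, Nat.mul_div_cancel_left _ hD]

theorem facetIndex_mul_add {D a : ℕ} (q : ℕ) (ha : a ≤ D) :
    facetIndex D ((D + 1) * q + a) = D * q + a := by
  rw [facetIndex, Nat.mul_add_div D.succ_pos, Nat.div_eq_of_lt (Nat.lt_succ_of_le ha), add_mul]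
  omega

theorem boxSize_succ (D t : ℕ) :
    boxSize (D + 1) (t + 1) = boxSize (D + 1) t + boxSize D (facetIndex D t) := by
  obtain ⟨q, a, ha, rfl⟩ := exists_eq_mul_add D t
  rw [facetIndex_mul_add q ha, boxSize_mul_add q ha, add_assoc, boxSize_mul_add q (by omega),
    boxSize_mul_add q (by omega), Nat.add_sub_add_right, Nat.sub_add_comm ha]
  ring

theorem boxShadow_succ (D t : ℕ) :
    boxShadow (D + 1) (t + 1) = boxShadow (D + 1) t + boxShadow D (facetIndex D t) := by
  obtain ⟨q, a, ha, rfl⟩ := exists_eq_mul_add D t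
  rw [facetIndex_mul_add q ha, boxShadow_mul_add q ha, add_assoc, boxShadow_mul_add q (by omega),
    boxShadow_mul_add q (by omega)]
  obtain ⟨e, rfl⟩ := Nat.exists_eq_add_of_le ha
  have he : a + e + 1 - a = e + 1 := by omega
  have he' : a + e + 1 - (a + 1) = e := by omega
  rw [he, he', Nat.add_sub_cancel_left]
  rcases a with _ | a <;> rcases e with _ | e <;> simp only [Nat.add_sub_cancel] <;> ring

theorem boxSize_pos (D t : ℕ) : 0 < boxSize D t := by
  unfold boxSize
  positivity

theorem boxSize_zero (D : ℕ) : boxSize D 0 = 1 := by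
  simp [boxSize]

theorem boxShadow_zero (D : ℕ) : boxShadow D 0 = D := by
  simp [boxShadow]

theorem boxSize_strictMono (D : ℕ) : StrictMono (boxSize (D + 1)) :=
  strictMono_nat_of_lt_succ fun t => by
    rw [boxSize_succ]
    exact Nat.lt_add_of_pos_right (boxSize_pos _ _)

theorem facetIndex_mono (D : ℕ) : Monotone (facetIndex D) :=
  monotone_nat_of_le_succ fun t => by
    have h : (t + 1) / (D + 1) ≤ t / (D + 1) + 1 :=
      (Nat.div_le_div_right (by omega)).trans (Nat.add_div_right t D.succ_pos).le
    unfold facetIndex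
    omega

theorem facetIndex_zero_left (t : ℕ) : facetIndex 0 t = 0 := by
  simp [facetIndex]

theorem boxSize_facetIndex_mono (D : ℕ) : Monotone fun t => boxSize D (facetIndex D t) := by
  cases D with
  | zero => simpa only [facetIndex_zero_left] using monotone_const
  | succ D => exact (boxSize_strictMono D).monotone.comp (facetIndex_mono _)

theorem mul_boxSize_facetIndex {D a : ℕ} (q : ℕ) (ha : a ≤ D) :
    (q + 2) * boxSize D (facetIndex D ((D + 1) * q + a)) =
      boxSize (D + 1) ((D + 1) * q + a + 1) := by
  rw [facetIndex_mul_add q ha, add_assoc, boxSize_mul_add q ha, boxSize_mul_add q (by omega),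
    Nat.add_sub_add_right]
  ring

theorem boxSize_le_pow {D a : ℕ} (q : ℕ) (ha : a ≤ D) : boxSize D (D * q + a) ≤ (q + 2) ^ D := by
  rw [boxSize_mul_add q ha]
  calc (q + 2) ^ a * (q + 1) ^ (D - a) ≤ (q + 2) ^ a * (q + 2) ^ (D - a) := by gcongr; omega
    _ = (q + 2) ^ D := by rw [← pow_add, Nat.add_sub_cancel' ha]

theorem pow_le_boxSize {D a : ℕ} (q : ℕ) (ha : a ≤ D) : (q + 1) ^ D ≤ boxSize D (D * q + a) := by
  rw [boxSize_mul_add q ha]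
  calc (q + 1) ^ D = (q + 1) ^ a * (q + 1) ^ (D - a) := by rw [← pow_add, Nat.add_sub_cancel' ha]
    _ ≤ (q + 2) ^ a * (q + 1) ^ (D - a) := by gcongr; omega

/-- The index of the largest box of the chain with at most `n` points (for `n = 0`, the junk value
`0`). -/
def boxRank (D n : ℕ) : ℕ :=
  Nat.findGreatest (fun t => boxSize (D + 1) t ≤ n) n

theorem boxRank_add {D t r : ℕ} (hr : r < boxSize D (facetIndex D t)) :
    boxRank D (boxSize (D + 1) t + r) = t := by
  refine Nat.findGreatest_eq_iff.2 ⟨(boxSize_strictMono D).le_apply.trans (Nat.le_add_right _ _),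
    fun _ => Nat.le_add_right _ _, fun s hs _ => not_le.2 ?_⟩
  calc boxSize (D + 1) t + r < boxSize (D + 1) (t + 1) := by rw [boxSize_succ]; omega
    _ ≤ boxSize (D + 1) s := (boxSize_strictMono D).monotone hs

theorem exists_eq_boxSize_add (D : ℕ) {n : ℕ} (hn : n ≠ 0) :
    ∃ t r, r < boxSize D (facetIndex D t) ∧ n = boxSize (D + 1) t + r := by
  obtain ⟨t, ht, htn⟩ : ∃ t, boxSize (D + 1) t < n + 1 ∧ n + 1 ≤ boxSize (D + 1) (t + 1) :=
    (boxSize_strictMono D).exists_between_of_tendsto_atTop (boxSize_strictMono D).tendsto_atTop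
      (by rw [boxSize_zero]; omega)
  rw [boxSize_succ] at htn
  exact ⟨t, n - boxSize (D + 1) t, by omega, by omega⟩

/-- The total size of the coordinate projections of the first `n` points in dimension `D`, which
arise from the largest box of the chain with at most `n` points by adding the first points of its
next facet. -/
def minShadow : ℕ → ℕ → ℕ
  | 0, _ => 0
  | D + 1, n =>
    if n = 0 then 0
    else boxShadow (D + 1) (boxRank D n) + minShadow D (n - boxSize (D + 1) (boxRank D n))

@[simp]
theorem minShadow_zero_left (n : ℕ) : minShadow 0 n = 0 := by
  rw [minShadow]

@[simp]
theorem minShadow_zero (D : ℕ) : minShadow D 0 = 0 := by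
  cases D <;> simp [minShadow]

theorem minShadow_add_of_lt {D t r : ℕ} (hr : r < boxSize D (facetIndex D t)) :
    minShadow (D + 1) (boxSize (D + 1) t + r) = boxShadow (D + 1) t + minShadow D r := by
  have h := boxSize_pos (D + 1) t
  rw [minShadow, if_neg (by omega), boxRank_add hr, Nat.add_sub_cancel_left]

theorem minShadow_boxSize (D t : ℕ) :
    minShadow (D + 1) (boxSize (D + 1) t) = boxShadow (D + 1) t := by
  simpa using minShadow_add_of_lt (r := 0) (boxSize_pos D (facetIndex D t))

theorem minShadow_boxSize_facetIndex (D t : ℕ) :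
    minShadow D (boxSize D (facetIndex D t)) = boxShadow D (facetIndex D t) := by
  cases D with
  | zero => rw [facetIndex_zero_left, boxShadow_zero, minShadow_zero_left]
  | succ D => exact minShadow_boxSize D _

theorem minShadow_boxSize_succ (D t : ℕ) :
    minShadow (D + 1) (boxSize (D + 1) (t + 1)) =
      minShadow (D + 1) (boxSize (D + 1) t) + minShadow D (boxSize D (facetIndex D t)) := by
  rw [minShadow_boxSize, minShadow_boxSize, minShadow_boxSize_facetIndex, boxShadow_succ]

theorem minShadow_add {D t r : ℕ} (hr : r ≤ boxSize D (facetIndex D t)) :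
    minShadow (D + 1) (boxSize (D + 1) t + r) =
      minShadow (D + 1) (boxSize (D + 1) t) + minShadow D r := by
  rcases hr.lt_or_eq with h | rfl
  · rw [minShadow_add_of_lt h, minShadow_boxSize]
  · rw [← boxSize_succ, minShadow_boxSize_succ]

theorem minShadow_one (D : ℕ) : minShadow D 1 = D := by
  cases D with
  | zero => exact minShadow_zero_left 1
  | succ D => simpa only [boxSize_zero, boxShadow_zero] using minShadow_boxSize D 0

/-- Subadditivity of `minShadow D`. -/
def ShadowSubadditive (D : ℕ) : Prop :=
  ∀ x y, minShadow D (x + y) ≤ minShadow D x + minShadow D y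

/-- Concentration decreases `minShadow D`: among the pairs of numbers with a given sum and bounded
by the size of a box, those which contain the size of the box have the smallest total. This is
proved simultaneously with `ShadowSubadditive`, by induction on the dimension. -/
def ShadowExtremal (D : ℕ) : Prop :=
  ∀ t r x y, r + boxSize D t = x + y → x ≤ boxSize D t → y ≤ boxSize D t →
    minShadow D r + minShadow D (boxSize D t) ≤ minShadow D x + minShadow D y

section Step

variable {D : ℕ}

theorem minShadow_boxSize_add_le (hsub : ShadowSubadditive D) (v c : ℕ) :
    minShadow (D + 1) (boxSize (D + 1) v) + minShadow D c ≤
      minShadow (D + 1) (boxSize (D + 1) v + c) := by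
  induction c using Nat.strong_induction_on generalizing v with
  | _ c ih =>
    rcases le_or_gt c (boxSize D (facetIndex D v)) with h | h
    · rw [minShadow_add h]
    · have hpos := boxSize_pos D (facetIndex D v)
      obtain ⟨e, rfl⟩ := Nat.exists_eq_add_of_le h.le
      have hrest := ih e (by omega) (v + 1)
      rw [boxSize_succ, add_assoc, ← boxSize_succ, minShadow_boxSize_succ] at hrest
      have hsplit := hsub (boxSize D (facetIndex D v)) e
      omega

theorem minShadow_le_succ (hsub : ShadowSubadditive D) (c : ℕ) :
    minShadow D c ≤ minShadow (D + 1) c := by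
  rcases c with _ | e
  · simp
  have hone := minShadow_boxSize_add_le hsub 0 e
  have hsplit := hsub e 1
  rw [boxSize_zero, minShadow_one, add_comm 1 e] at hone
  rw [minShadow_one] at hsplit
  omega

theorem minShadow_add_facet_le (hsub : ShadowSubadditive D) (hext : ShadowExtremal D)
    {u r c e : ℕ} (hr : r + c ≤ boxSize (D + 1) (u + 1))
    (hc : c + e = boxSize D (facetIndex D u)) :
    minShadow (D + 1) r + minShadow D (boxSize D (facetIndex D u)) ≤
      minShadow (D + 1) (r + c) + minShadow D e := by
  rcases Nat.eq_zero_or_pos c with rfl | hc0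
  · simp [← hc]
  rcases Nat.eq_zero_or_pos r with rfl | hr0
  · have hsplit := hsub c e
    have hup := minShadow_le_succ hsub c
    rw [hc] at hsplit
    simp only [minShadow_zero, zero_add]
    omega
  obtain ⟨v, ρ, hρ, rfl⟩ := exists_eq_boxSize_add D hr0.ne'
  have hvu : v ≤ u := by
    have : boxSize (D + 1) v < boxSize (D + 1) (u + 1) := by omega
    exact Nat.le_of_lt_succ ((boxSize_strictMono D).lt_iff_lt.1 this)
  have hf : boxSize D (facetIndex D v) ≤ boxSize D (facetIndex D u) :=
    boxSize_facetIndex_mono D hvu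
  rw [minShadow_add hρ.le]
  rcases le_or_gt (ρ + c) (boxSize D (facetIndex D v)) with h | h
  · rw [add_assoc (boxSize (D + 1) v), minShadow_add h]
    have := hext (facetIndex D u) ρ (ρ + c) e (by omega) (by omega) (by omega)
    omega
  · obtain ⟨x, hx⟩ := Nat.exists_eq_add_of_le hρ.le
    obtain ⟨c', rfl⟩ := Nat.exists_eq_add_of_le (show x ≤ c by omega)
    have hbox := minShadow_boxSize_add_le hsub (v + 1) c'
    have heq : boxSize (D + 1) (v + 1) + c' = boxSize (D + 1) v + ρ + (x + c') := by
      rw [boxSize_succ]; omega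
    rw [minShadow_boxSize_succ, heq] at hbox
    have hmove := hext (facetIndex D u) ρ (boxSize D (facetIndex D v)) (c' + e) (by omega) hf
      (by omega)
    have hsplit := hsub c' e
    omega

theorem ShadowExtremal.of_le (hsub : ShadowSubadditive D) (hext : ShadowExtremal D) {t r x y : ℕ}
    (h : r + boxSize (D + 1) (t + 1) = x + y) (hx : x ≤ boxSize (D + 1) (t + 1))
    (hy : y ≤ boxSize (D + 1) (t + 1)) (hty : boxSize (D + 1) t ≤ y) :
    minShadow (D + 1) r + minShadow (D + 1) (boxSize (D + 1) (t + 1)) ≤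
      minShadow (D + 1) x + minShadow (D + 1) y := by
  have hs := boxSize_succ D t
  obtain ⟨e, rfl⟩ := Nat.exists_eq_add_of_le hty
  obtain ⟨c, rfl⟩ := Nat.exists_eq_add_of_le (show r ≤ x by omega)
  have hfacet := minShadow_add_facet_le hsub hext (u := t) (e := e) hx (by omega)
  rw [minShadow_boxSize_succ, minShadow_add (by omega)]
  omega

theorem ShadowExtremal.succ (hsub : ShadowSubadditive D) (hext : ShadowExtremal D) :
    ShadowExtremal (D + 1) := by
  intro t
  induction t with
  | zero =>
    intro r x y h hx hy
    rw [boxSize_zero] at *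
    obtain ⟨rfl, rfl⟩ | ⟨rfl, rfl⟩ : (x = r ∧ y = 1) ∨ (x = 1 ∧ y = r) := by omega
    · rfl
    · rw [add_comm]
  | succ t ih =>
    intro r x y h hx hy
    rcases le_or_gt (boxSize (D + 1) t) y with hty | hty
    · exact ShadowExtremal.of_le hsub hext h hx hy hty
    rcases le_or_gt (boxSize (D + 1) t) x with htx | htx
    · rw [add_comm (minShadow _ x)]
      exact ShadowExtremal.of_le hsub hext (h.trans (add_comm _ _)) hy hx htx
    have hs := boxSize_strictMono D (Nat.lt_add_one t)
    obtain ⟨w, hw⟩ := Nat.exists_eq_add_of_le (show boxSize (D + 1) t ≤ x + y by omega)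
    calc minShadow (D + 1) r + minShadow (D + 1) (boxSize (D + 1) (t + 1))
        ≤ minShadow (D + 1) w + minShadow (D + 1) (boxSize (D + 1) t) :=
          ShadowExtremal.of_le hsub hext (by omega) (by omega) hs.le le_rfl
      _ ≤ minShadow (D + 1) x + minShadow (D + 1) y := ih w x y (by omega) htx.le hty.le

theorem minShadow_boxSize_add_add_le (hsub : ShadowSubadditive D) {u ρ y : ℕ}
    (h : ρ + y ≤ boxSize D (facetIndex D u)) :
    minShadow (D + 1) (boxSize (D + 1) u + ρ + y) ≤
      minShadow (D + 1) (boxSize (D + 1) u + ρ) + minShadow D y := by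
  rw [add_assoc, minShadow_add h, minShadow_add (by omega), add_assoc]
  exact Nat.add_le_add_left (hsub ρ y) _

theorem ShadowSubadditive.succ (hsub : ShadowSubadditive D) (hext : ShadowExtremal (D + 1)) :
    ShadowSubadditive (D + 1) := by
  intro x y
  rcases eq_or_ne (x + y) 0 with h0 | h0
  · simp [h0]
  obtain ⟨u, σ, hσ, h⟩ := exists_eq_boxSize_add D h0
  rcases le_or_gt (boxSize (D + 1) u) x with hx | hx
  · obtain ⟨ρ, rfl⟩ := Nat.exists_eq_add_of_le hx
    exact (minShadow_boxSize_add_add_le hsub (by omega)).trans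
      (Nat.add_le_add_left (minShadow_le_succ hsub y) _)
  rcases le_or_gt (boxSize (D + 1) u) y with hy | hy
  · obtain ⟨ρ, rfl⟩ := Nat.exists_eq_add_of_le hy
    rw [add_comm x, add_comm (minShadow _ x)]
    exact (minShadow_boxSize_add_add_le hsub (by omega)).trans
      (Nat.add_le_add_left (minShadow_le_succ hsub x) _)
  have hmove := hext u σ x y (by omega) hx.le hy.le
  have hup := minShadow_le_succ hsub σ
  rw [h, minShadow_add hσ.le]
  omega

end Step

theorem shadowSubadditive_and_extremal (D : ℕ) : ShadowSubadditive D ∧ ShadowExtremal D := by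
  induction D with
  | zero => exact ⟨fun _ _ => by simp, fun _ _ _ _ _ _ _ => by simp⟩
  | succ D ih =>
    have hext := ShadowExtremal.succ ih.1 ih.2
    exact ⟨ShadowSubadditive.succ ih.1 hext, hext⟩

theorem add_two_le_of_boxSize_lt_pow {D a m : ℕ} (q : ℕ) (ha : a ≤ D)
    (h : boxSize D (D * q + a) < m ^ D) : q + 2 ≤ m :=
  lt_of_pow_lt_pow_left₀ D (Nat.zero_le m) ((pow_le_boxSize q ha).trans_lt h)

theorem le_boxSize_facetIndex {D t m n b : ℕ} (htn : boxSize (D + 1) t < n)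
    (hnt : n ≤ boxSize (D + 1) (t + 1)) (hn : n ≤ m ^ (D + 1)) (hb : m * b ≤ n) :
    b ≤ boxSize D (facetIndex D t) := by
  obtain ⟨q, a, ha, rfl⟩ := exists_eq_mul_add D t
  have hqm : q + 2 ≤ m := add_two_le_of_boxSize_lt_pow q (ha.trans D.le_succ) (htn.trans_le hn)
  refine Nat.le_of_mul_le_mul_left (c := q + 2) ?_ (by omega)
  calc (q + 2) * b ≤ m * b := Nat.mul_le_mul_right b hqm
    _ ≤ n := hb
    _ ≤ _ := by rwa [mul_boxSize_facetIndex q ha]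

theorem minShadow_boxSize_succ_add_le {D t r b e : ℕ} (he : b + e = boxSize D (facetIndex D t))
    (hrb : r ≤ b) :
    minShadow (D + 1) (boxSize (D + 1) (t + 1) + r) ≤
      minShadow (D + 1) (boxSize (D + 1) t + (r + e)) + minShadow D b := by
  have hmono : boxSize D (facetIndex D t) ≤ boxSize D (facetIndex D (t + 1)) :=
    boxSize_facetIndex_mono D t.le_succ
  have hmove := (shadowSubadditive_and_extremal D).2 (facetIndex D t) r (r + e) b (by omega)
    (by omega) (by omega)
  rw [minShadow_add (by omega), minShadow_add (by omega), minShadow_boxSize_succ]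
  omega

theorem minShadow_boxSize_succ_add_add_le {D t r s : ℕ}
    (ht : facetIndex (D + 1) (t + 1) = facetIndex (D + 1) t + 1)
    (hs : s ≤ boxSize D (facetIndex D (facetIndex (D + 1) t)))
    (hr : r ≤ boxSize (D + 1) (facetIndex (D + 1) t))
    (hrs : minShadow (D + 1) (r + s) ≤ minShadow (D + 1) r + minShadow D s) :
    minShadow (D + 1 + 1) (boxSize (D + 1 + 1) (t + 1) + (r + s)) ≤
      minShadow (D + 1 + 1) (boxSize (D + 1 + 1) t + r) +
        minShadow (D + 1) (boxSize (D + 1) (facetIndex (D + 1) t) + s) := by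
  have hrs' : r + s ≤ boxSize (D + 1) (facetIndex (D + 1) (t + 1)) := by
    rw [ht, boxSize_succ]; omega
  rw [minShadow_add hrs', minShadow_add hr, minShadow_add hs, minShadow_boxSize_succ]
  omega

theorem facetIndex_succ {D a : ℕ} (q : ℕ) (ha : a < D) :
    facetIndex D ((D + 1) * q + a + 1) = facetIndex D ((D + 1) * q + a) + 1 := by
  rw [add_assoc, facetIndex_mul_add q ha, facetIndex_mul_add q ha.le, add_assoc]

theorem facetIndex_succ_of_eq (D q : ℕ) :
    facetIndex D ((D + 1) * q + D + 1) = facetIndex D ((D + 1) * q + D) := by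
  rw [facetIndex_mul_add q le_rfl]
  have := facetIndex_mul_add (D := D) (q + 1) (Nat.zero_le _)
  rwa [add_zero, add_zero, mul_add_one, mul_add_one, ← add_assoc] at this

theorem minShadow_le_sub_add_of_boxSize_lt {D m t r b : ℕ}
    (ih : ∀ {m n b : ℕ}, 2 ≤ m → m * b ≤ n → n ≤ m ^ D →
      minShadow D n ≤ minShadow D (n - b) + minShadow (D - 1) b)
    (hr : r < boxSize D (facetIndex D (t + 1))) (hrb : r + 1 < b)
    (hbt : boxSize D (facetIndex D t) < b)
    (hbf : b ≤ boxSize D (facetIndex D (t + 1))) (hb : m * b ≤ boxSize (D + 1) (t + 1) + (r + 1))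
    (hn : boxSize (D + 1) (t + 1) + (r + 1) ≤ m ^ (D + 1)) :
    minShadow (D + 1) (boxSize (D + 1) (t + 1) + (r + 1)) ≤
      minShadow (D + 1) (boxSize (D + 1) (t + 1) + (r + 1) - b) + minShadow D b := by
  have hbox := boxSize_succ D t
  obtain ⟨s, rfl⟩ := Nat.exists_eq_add_of_le hbt.le
  obtain ⟨q, a, ha, rfl⟩ := exists_eq_mul_add D t
  rcases ha.eq_or_lt with rfl | ha
  · rw [facetIndex_succ_of_eq] at hbf
    omega
  obtain ⟨D, rfl⟩ := Nat.exists_eq_add_of_le' (Nat.one_le_of_lt ha)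
  have hqm : q + 2 ≤ m := add_two_le_of_boxSize_lt_pow (D := D + 1 + 1) (a := a) q (by omega)
    (lt_of_lt_of_le (by omega) hn)
  have hqs : (q + 2) * s ≤ r + 1 := by
    have hqf := mul_boxSize_facetIndex q ha.le
    have hqb := (Nat.mul_le_mul_right _ hqm).trans hb
    rw [mul_add] at hqb
    omega
  have hsr : s ≤ r + 1 := (Nat.le_mul_of_pos_left s (by omega)).trans hqs
  rw [facetIndex_succ q ha, boxSize_succ] at hbf
  have hrq : r + 1 ≤ (q + 2) ^ (D + 1) := by
    rw [add_assoc, facetIndex_mul_add q ha] at hr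
    exact (Nat.succ_le_of_lt hr).trans (boxSize_le_pow q ha)
  have h := minShadow_boxSize_succ_add_add_le (r := r + 1 - s) (s := s) (facetIndex_succ q ha)
    (by omega) (by omega) (by rw [Nat.sub_add_cancel hsr]; exact ih (by omega) hqs hrq)
  rw [Nat.sub_add_cancel hsr] at h
  convert h using 3
  omega

/-- The hypotheses hold if `b` is the size of the smallest of `m` slices of an `n`-element set, and
`m` is the largest number of slices in any direction. -/
theorem minShadow_le_sub_add (D : ℕ) : ∀ {m n b : ℕ}, 2 ≤ m → m * b ≤ n → n ≤ m ^ D →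
    minShadow D n ≤ minShadow D (n - b) + minShadow (D - 1) b := by
  induction D with
  | zero => simp
  | succ D ih =>
    intro m n b hm hb hn
    rcases Nat.eq_zero_or_pos b with rfl | hb0
    · simp
    have hn2 : 2 * 1 ≤ n := (Nat.mul_le_mul hm hb0).trans hb
    obtain ⟨t, r, hr, hnr⟩ := exists_eq_boxSize_add D (n := n - 1) (by omega)
    obtain rfl : n = boxSize (D + 1) t + (r + 1) := by omega
    have hbf : b ≤ boxSize D (facetIndex D t) :=
      le_boxSize_facetIndex (by omega) (by rw [boxSize_succ]; omega) hn hb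
    rw [Nat.add_sub_cancel]
    rcases le_or_gt b (r + 1) with hbr | hbr
    · obtain ⟨e, he⟩ := Nat.exists_eq_add_of_le' hbr
      rw [he, ← add_assoc, Nat.add_sub_cancel]
      have heb : e + b ≤ boxSize D (facetIndex D t) := by omega
      exact minShadow_boxSize_add_add_le (shadowSubadditive_and_extremal D).1 heb
    rcases t with _ | t
    · have : facetIndex D 0 = 0 := by simp [facetIndex]
      rw [this, boxSize_zero] at hbf
      omega
    rcases le_or_gt b (boxSize D (facetIndex D t)) with hbt | hbt
    · obtain ⟨e, he⟩ := Nat.exists_eq_add_of_le hbt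
      have hbox := boxSize_succ D t
      have h := minShadow_boxSize_succ_add_le he.symm hbr.le
      rwa [show boxSize (D + 1) t + (r + 1 + e) = boxSize (D + 1) (t + 1) + (r + 1) - b by omega]
        at h
    exact minShadow_le_sub_add_of_boxSize_lt ih hr hbr hbt hbf hb hn

/-! ### Projections -/

section Shadow

variable {ι α : Type*}

/-- The coordinates outside `S` are constant on `C`, so that `C` is in essence a set of tuples
indexed by `S`. -/
def IsConstOff (S : Finset ι) (C : Finset (ι → α)) : Prop :=
  ∀ x ∈ C, ∀ y ∈ C, ∀ i ∉ S, x i = y i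

theorem IsConstOff.mono {S : Finset ι} {C C' : Finset (ι → α)} (hC : IsConstOff S C)
    (h : C' ⊆ C) : IsConstOff S C' :=
  fun x hx y hy => hC x (h hx) y (h hy)

variable [DecidableEq α]

theorem IsConstOff.card_le_pow {S : Finset ι} {C : Finset (ι → α)} {m : ℕ} (hC : IsConstOff S C)
    (hm : ∀ i ∈ S, #(C.image fun x => x i) ≤ m) : #C ≤ m ^ #S := by
  classical
  calc #C ≤ #(S.pi fun i => C.image fun x => x i) := by
        refine card_le_card_of_injOn (fun x i _ => x i) ?_ ?_
        · exact fun x hx => mem_coe.2 (mem_pi.2 fun i _ => mem_image_of_mem _ hx)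
        · intro x hx y hy hxy
          funext i
          by_cases hi : i ∈ S
          · exact congrFun (congrFun hxy i) hi
          · exact hC x hx y hy i hi
    _ = ∏ i ∈ S, #(C.image fun x => x i) := card_pi _ _
    _ ≤ m ^ #S := prod_le_pow_card _ _ _ hm

theorem exists_mul_card_slice_le {C : Finset (ι → α)} (hC : C.Nonempty) (i : ι) :
    ∃ v, ({x ∈ C | x i = v}).Nonempty ∧
      #(C.image fun x => x i) * #{x ∈ C | x i = v} ≤ #C := by
  obtain ⟨v, hv, hmin⟩ := exists_min_image (C.image fun x : ι → α => x i)
    (fun v => #{x ∈ C | x i = v}) (hC.image _)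
  obtain ⟨x, hx, hxv⟩ := mem_image.1 hv
  refine ⟨v, ⟨x, mem_filter.2 ⟨hx, hxv⟩⟩, ?_⟩
  rw [card_eq_sum_card_image (fun x => x i) C]
  exact card_nsmul_le_sum _ _ _ hmin

theorem IsConstOff.exists_thin_slice {S : Finset ι} {C : Finset (ι → α)} (hC : IsConstOff S C)
    (hcard : 1 < #C) : ∃ i ∈ S, ∃ v, ∃ m, 2 ≤ m ∧ #C ≤ m ^ #S ∧
      ({x ∈ C | x i = v}).Nonempty ∧ m * #{x ∈ C | x i = v} ≤ #C := by
  have hS : S.Nonempty := by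
    rw [nonempty_iff_ne_empty]
    rintro rfl
    exact hcard.not_ge (hC.card_le_pow (m := 0) (by simp))
  obtain ⟨i, hi, hmax⟩ := exists_max_image S (fun i => #(C.image fun x => x i)) hS
  have hpow := hC.card_le_pow hmax
  obtain ⟨v, hne, hle⟩ := exists_mul_card_slice_le (card_pos.1 (zero_lt_one.trans hcard)) i
  refine ⟨i, hi, v, _, ?_, hpow, hne, hle⟩
  by_contra! hm
  exact (hcard.trans_le (hpow.trans (Nat.pow_le_pow_left (Nat.le_of_lt_succ hm) _))).ne
    (one_pow _).symm

variable [DecidableEq ι]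

theorem IsConstOff.slice {S : Finset ι} {C : Finset (ι → α)} (hC : IsConstOff S C) (i : ι)
    (v : α) : IsConstOff (S.erase i) {x ∈ C | x i = v} := by
  intro x hx y hy j hj
  obtain ⟨hxC, hxi⟩ := mem_filter.1 hx
  obtain ⟨hyC, hyi⟩ := mem_filter.1 hy
  by_cases hji : j = i
  · rw [hji, hxi, hyi]
  · exact hC x hxC y hyC j fun hjS => hj (mem_erase.2 ⟨hji, hjS⟩)

variable [Fintype ι] [Zero α]

/-- The projection of `C` along the direction `i`, as a subset of the hyperplane where the
coordinate `i` vanishes. -/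
def axisShadow (i : ι) (C : Finset (ι → α)) : Finset (ι → α) :=
  C.image fun x => update x i 0

/-- The total number of points in the projections of `C` along the directions in `S`. -/
def shadowSum (S : Finset ι) (C : Finset (ι → α)) : ℕ :=
  ∑ i ∈ S, #(axisShadow i C)

theorem axisShadow_mono (i : ι) {C C' : Finset (ι → α)} (h : C ⊆ C') :
    axisShadow i C ⊆ axisShadow i C' :=
  image_subset_image h

theorem disjoint_axisShadow_slice {i j : ι} (hij : i ≠ j) (C : Finset (ι → α)) (v : α) :
    Disjoint (axisShadow j {x ∈ C | x i ≠ v}) (axisShadow j {x ∈ C | x i = v}) := by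
  rw [disjoint_left]
  intro p hp hp'
  obtain ⟨x, hx, rfl⟩ := mem_image.1 hp
  obtain ⟨y, hy, hxy⟩ := mem_image.1 hp'
  have h := congrFun hxy i
  rw [update_of_ne hij, update_of_ne hij] at h
  exact (mem_filter.1 hx).2 (h ▸ (mem_filter.1 hy).2)

theorem shadowSum_slice_add_le {S : Finset ι} {i : ι} (hi : i ∈ S) (C : Finset (ι → α)) (v : α) :
    shadowSum S {x ∈ C | x i ≠ v} + shadowSum (S.erase i) {x ∈ C | x i = v} ≤ shadowSum S C := by
  unfold shadowSum
  rw [← add_sum_erase S _ hi, ← add_sum_erase S _ hi, add_assoc, ← sum_add_distrib]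
  refine add_le_add (card_le_card (axisShadow_mono i (filter_subset _ _)))
    (sum_le_sum fun j hj => ?_)
  rw [← card_union_of_disjoint (disjoint_axisShadow_slice (ne_of_mem_erase hj).symm C v)]
  exact card_le_card (union_subset (axisShadow_mono j (filter_subset _ _))
    (axisShadow_mono j (filter_subset _ _)))

theorem card_le_shadowSum (S : Finset ι) {C : Finset (ι → α)} (hC : C.Nonempty) :
    #S ≤ shadowSum S C := by
  rw [card_eq_sum_ones]
  exact sum_le_sum fun i _ => card_pos.2 (hC.image _)

theorem minShadow_le_shadowSum (S : Finset ι) (C : Finset (ι → α)) (hC : IsConstOff S C) :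
    minShadow #S #C ≤ shadowSum S C := by
  induction hN : #C using Nat.strong_induction_on generalizing S C with
  | _ N ih =>
  subst hN
  rcases C.eq_empty_or_nonempty with rfl | hne
  · simp
  rcases le_or_gt #C 1 with h1 | h1
  · rw [le_antisymm h1 hne.card_pos, minShadow_one]
    exact card_le_shadowSum S hne
  obtain ⟨i, hi, v, m, hm, hpow, hslice, hmul⟩ := hC.exists_thin_slice h1
  have hadd : #{x ∈ C | x i = v} + #{x ∈ C | x i ≠ v} = #C :=
    card_filter_add_card_filter_not _
  have hpos := hslice.card_pos
  have hlt : #{x ∈ C | x i = v} < #C := by nlinarith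
  have hrest := ih _ (by omega) S _ (hC.mono (filter_subset (fun x => x i ≠ v) C)) rfl
  have hthin := ih _ hlt (S.erase i) _ (hC.slice i v) rfl
  have hnum := minShadow_le_sub_add #S hm hmul hpow
  have hshadow := shadowSum_slice_add_le hi C v
  rw [card_erase_of_mem hi] at hthin
  rw [← hadd, Nat.add_sub_cancel_left, hadd] at hnum
  omega

end Shadow

/-! ### The edge perimeter -/

section Perimeter

variable {d : ℕ}

theorem sum_sq_sub_update (x : Fin d → ℤ) (i : Fin d) (ε : ℤ) :
    ∑ j, (x j - update x i (x i + ε) j) ^ 2 = ε ^ 2 := by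
  rw [sum_eq_single_of_mem i (mem_univ i) fun j _ hj => by rw [update_of_ne hj]; ring,
    update_self]
  ring

theorem exists_eq_update_of_sum_sq {x y : Fin d → ℤ} (h : ∑ i, (x i - y i) ^ 2 = 1) :
    ∃ i, ∃ ε ∈ ({1, -1} : Finset ℤ), y = update x i (x i + ε) := by
  obtain ⟨i, hi⟩ : ∃ i, x i - y i ≠ 0 := by
    by_contra! h0
    simp [h0] at h
  have hsplit := add_sum_erase univ (fun i => (x i - y i) ^ 2) (mem_univ i)
  have hrest : 0 ≤ ∑ j ∈ univ.erase i, (x j - y j) ^ 2 := sum_nonneg fun j _ => sq_nonneg _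
  have hpos : 0 < (x i - y i) ^ 2 := by positivity
  have hone : (x i - y i) ^ 2 = 1 := by omega
  have hzero : ∑ j ∈ univ.erase i, (x j - y j) ^ 2 = 0 := by omega
  rw [sum_eq_zero_iff_of_nonneg fun j _ => sq_nonneg _] at hzero
  refine ⟨i, y i - x i, ?_, ?_⟩
  · rw [mem_insert, mem_singleton]
    rcases sq_eq_one_iff.1 hone with h | h <;> omega
  · funext j
    rcases eq_or_ne j i with rfl | hj
    · simp
    · rw [update_of_ne hj]
      exact (sub_eq_zero.1 (pow_eq_zero_iff two_ne_zero |>.1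
        (hzero j (mem_erase.2 ⟨hj, mem_univ _⟩)))).symm

theorem eq_and_eq_of_update_add_eq {x : Fin d → ℤ} {i j : Fin d} {ε δ : ℤ} (hε : ε ≠ 0)
    (h : update x i (x i + ε) = update x j (x j + δ)) : i = j ∧ ε = δ := by
  have hi := congrFun h i
  rcases eq_or_ne i j with rfl | hij
  · simpa using hi
  · rw [update_self, update_of_ne hij] at hi
    omega

/-- The points of `C` at which a step in the direction `ε` along the axis `i` leaves `C`. -/
def exitPoints (C : Finset (Fin d → ℤ)) (i : Fin d) (ε : ℤ) : Finset (Fin d → ℤ) :=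
  {x ∈ C | update x i (x i + ε) ∉ C}

theorem edgeBoundary_eq_image (C : Finset (Fin d → ℤ)) :
    edgeBoundary (C : Set (Fin d → ℤ)) =
      (fun e : Σ _ : Fin d, Σ _ : ℤ, Fin d → ℤ => (e.2.2, update e.2.2 e.1 (e.2.2 e.1 + e.2.1))) ''
        (univ.sigma fun i => ({1, -1} : Finset ℤ).sigma fun ε => exitPoints C i ε) := by
  ext ⟨x, y⟩
  constructor
  · rintro ⟨hxy, hx, hy⟩
    obtain ⟨i, ε, hε, hyx⟩ := exists_eq_update_of_sum_sq (x := x) (y := y) hxy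
    subst hyx
    exact ⟨⟨i, ε, x⟩, by simpa [exitPoints] using ⟨by simpa using hε, hx, hy⟩, rfl⟩
  · rintro ⟨⟨i, ε, z⟩, hz, h⟩
    obtain ⟨rfl, rfl⟩ := Prod.mk.inj h
    simp only [exitPoints, coe_sigma, Set.mem_sigma_iff, mem_coe, mem_insert, mem_singleton,
      mem_filter] at hz
    refine ⟨?_, hz.2.2⟩
    rw [sum_sq_sub_update]
    rcases hz.2.1 with rfl | rfl <;> norm_num

theorem edgePerimeter_eq_sum_exitPoints (C : Finset (Fin d → ℤ)) :
    edgePerimeter (C : Set (Fin d → ℤ)) =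
      (∑ i, ∑ ε ∈ ({1, -1} : Finset ℤ), #(exitPoints C i ε) : ℕ) := by
  rw [edgePerimeter, edgeBoundary_eq_image, Set.InjOn.encard_image,
    Set.encard_coe_eq_coe_finsetCard, card_sigma]
  · simp only [card_sigma]
  · rintro ⟨i, ε, x⟩ hx ⟨j, δ, y⟩ - h
    obtain ⟨rfl, h⟩ := Prod.mk.inj h
    have hε : ε ≠ 0 := by
      simp only [coe_sigma, Set.mem_sigma_iff, mem_coe, mem_insert, mem_singleton] at hx
      rcases hx.2.1 with rfl | rfl <;> decide
    obtain ⟨rfl, rfl⟩ := eq_and_eq_of_update_add_eq hε h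
    rfl

theorem card_axisShadow_le_card_exitPoints (C : Finset (Fin d → ℤ)) (i : Fin d) {ε : ℤ}
    (hε : ε ≠ 0) : #(axisShadow i C) ≤ #(exitPoints C i ε) := by
  refine (card_le_card fun p hp => ?_).trans (card_image_le (f := fun x => update x i 0))
  obtain ⟨y, hy, hyp⟩ := mem_image.1 hp
  obtain ⟨x, hx, hmax⟩ := exists_max_image {x ∈ C | update x i 0 = p} (fun x => ε * x i)
    ⟨y, mem_filter.2 ⟨hy, hyp⟩⟩
  obtain ⟨hxC, hxp⟩ := mem_filter.1 hx
  refine mem_image.2 ⟨x, mem_filter.2 ⟨hxC, fun hmem => ?_⟩, hxp⟩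
  have hstep := hmax _ (mem_filter.2 ⟨hmem, by rwa [update_idem]⟩)
  rw [update_self] at hstep
  nlinarith [mul_self_pos.2 hε]

theorem update_eq_of_update_zero_eq {x y : Fin d → ℤ} {i : Fin d}
    (h : update x i 0 = update y i 0) : update x i (y i) = y := by
  simpa using congrArg (fun f => update f i (y i)) h

theorem mul_le_mul_of_mem_exitPoints {C : Finset (Fin d → ℤ)} {i : Fin d} {ε : ℤ}
    (hε : ε ∈ ({1, -1} : Finset ℤ)) (hC : ∀ x, Set.OrdConnected {k | update x i k ∈ C})
    {x y : Fin d → ℤ} (hx : x ∈ exitPoints C i ε) (hy : y ∈ C)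
    (hxy : update x i 0 = update y i 0) : ε * y i ≤ ε * x i := by
  obtain ⟨hxC, hexit⟩ := mem_filter.1 hx
  by_contra! hlt
  refine hexit ((hC x).uIcc_subset (x := x i) (y := y i) ?_ ?_ ?_)
  · rwa [Set.mem_ofPred_eq, update_eq_self]
  · rwa [Set.mem_ofPred_eq, update_eq_of_update_zero_eq hxy]
  · rw [Set.mem_uIcc]
    rw [mem_insert, mem_singleton] at hε
    rcases hε with rfl | rfl <;> omega

theorem card_exitPoints_le_card_axisShadow {C : Finset (Fin d → ℤ)} {i : Fin d} {ε : ℤ}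
    (hε : ε ∈ ({1, -1} : Finset ℤ)) (hC : ∀ x, Set.OrdConnected {k | update x i k ∈ C}) :
    #(exitPoints C i ε) ≤ #(axisShadow i C) := by
  refine card_le_card_of_injOn (fun x => update x i 0) ?_ ?_
  · exact fun x hx => mem_image_of_mem _ (mem_filter.1 hx).1
  · intro x hx y hy hxy
    have hle := mul_le_mul_of_mem_exitPoints hε hC hx (mem_filter.1 hy).1 hxy
    have hge := mul_le_mul_of_mem_exitPoints hε hC hy (mem_filter.1 hx).1 hxy.symm
    rw [mem_insert, mem_singleton] at hε
    have hi : x i = y i := by rcases hε with rfl | rfl <;> omega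
    rw [← update_eq_of_update_zero_eq hxy, ← hi, update_eq_self]

theorem sum_card_axisShadow (C : Finset (Fin d → ℤ)) :
    ∑ i, ∑ _ε ∈ ({1, -1} : Finset ℤ), #(axisShadow i C) = 2 * shadowSum univ C := by
  rw [shadowSum, mul_sum]
  exact sum_congr rfl fun i _ => by rw [sum_const, smul_eq_mul]; rfl

theorem two_mul_shadowSum_le_edgePerimeter (C : Finset (Fin d → ℤ)) :
    ((2 * shadowSum univ C : ℕ) : ℕ∞) ≤ edgePerimeter (C : Set (Fin d → ℤ)) := by
  rw [edgePerimeter_eq_sum_exitPoints, Nat.cast_le, ← sum_card_axisShadow]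
  refine sum_le_sum fun i _ => sum_le_sum fun ε hε => card_axisShadow_le_card_exitPoints C i ?_
  rw [mem_insert, mem_singleton] at hε
  rcases hε with rfl | rfl <;> decide

theorem edgePerimeter_le_two_mul_shadowSum {C : Finset (Fin d → ℤ)}
    (hC : ∀ x i, Set.OrdConnected {k | update x i k ∈ C}) :
    edgePerimeter (C : Set (Fin d → ℤ)) ≤ ((2 * shadowSum univ C : ℕ) : ℕ∞) := by
  rw [edgePerimeter_eq_sum_exitPoints, Nat.cast_le, ← sum_card_axisShadow]
  exact sum_le_sum fun i _ => sum_le_sum fun ε hε =>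
    card_exitPoints_le_card_axisShadow hε fun x => hC x i

theorem toLattice_injective : Injective (toLattice (d := d)) := by
  intro x y h
  funext i
  exact Int.ofNat_inj.1 (congrFun h i)

theorem toLattice_update (x : Fin d → ℕ) (i : Fin d) (k : ℕ) :
    toLattice (update x i k) = update (toLattice x) i (k : ℤ) := by
  funext j
  rcases eq_or_ne j i with rfl | hj
  · simp [toLattice]
  · simp [toLattice, update_of_ne hj]

theorem shadowSum_image_toLattice (S : Finset (Fin d)) (C : Finset (Fin d → ℕ)) :
    shadowSum S (C.image toLattice) = shadowSum S C := by
  refine sum_congr rfl fun i _ => ?_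
  have himage : axisShadow i (C.image toLattice) = (axisShadow i C).image toLattice := by
    simp only [axisShadow, image_image, comp_def, toLattice_update, Nat.cast_zero]
  rw [himage, card_image_of_injective _ toLattice_injective]

theorem ordConnected_section_image_toLattice {C : Finset (Fin d → ℕ)}
    (hpos : ∀ x ∈ C, IsPosTuple x)
    (hdown : ∀ x ∈ C, ∀ i k, 1 ≤ k → k ≤ x i → update x i k ∈ C) (x : Fin d → ℤ) (i : Fin d) :
    Set.OrdConnected {k | update x i k ∈ C.image toLattice} := by
  refine ⟨fun k hk l hl m hm => ?_⟩
  obtain ⟨u, hu, hux⟩ := mem_image.1 hk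
  obtain ⟨v, hv, hvx⟩ := mem_image.1 hl
  have hui : (u i : ℤ) = k := by simpa [toLattice] using congrFun hux i
  have hvi : (v i : ℤ) = l := by simpa [toLattice] using congrFun hvx i
  have hu1 := hpos u hu i
  obtain ⟨hkm, hml⟩ := hm
  lift m to ℕ using by omega
  refine mem_image.2 ⟨update v i m, hdown v hv i m (by omega) (by omega), ?_⟩
  rw [toLattice_update, hvx, update_idem]

theorem edgePerimeter_toLattice_le {C : Finset (Fin d → ℕ)} (hpos : ∀ x ∈ C, IsPosTuple x)
    (hdown : ∀ x ∈ C, ∀ i k, 1 ≤ k → k ≤ x i → update x i k ∈ C) :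
    edgePerimeter (toLattice '' (C : Set (Fin d → ℕ))) ≤
      ((2 * shadowSum univ C : ℕ) : ℕ∞) := by
  rw [← coe_image, ← shadowSum_image_toLattice]
  exact edgePerimeter_le_two_mul_shadowSum (ordConnected_section_image_toLattice hpos hdown)

end Perimeter

/-! ### The order -/

section Order

variable {d : ℕ} {S : Finset (Fin d)} {x y : Fin d → ℕ} {m : ℕ}

theorem le_tupleMax {i : Fin d} (hi : i ∈ S) : x i ≤ tupleMax S x :=
  le_sup hi

theorem tupleMax_eq {i : Fin d} (hi : i ∈ S) (him : x i = m) (hm : ∀ j ∈ S, x j ≤ m) :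
    tupleMax S x = m :=
  le_antisymm (Finset.sup_le hm) (him ▸ le_tupleMax hi)

theorem tupleTilde_lt_iff (hx : tupleMax S x = m) (hy : tupleMax S y = m) {i : Fin d} (hi : i ∈ S)
    (hxi : 1 ≤ x i) : tupleTilde S x i < tupleTilde S y i ↔ x i < m ∧ y i = m := by
  have hxm := le_tupleMax (x := x) hi
  have hym := le_tupleMax (x := y) hi
  unfold tupleTilde
  split_ifs <;> omega

theorem tupleTilde_eq_iff (hx : tupleMax S x = m) (hy : tupleMax S y = m) {i : Fin d} (hi : i ∈ S)
    (hxi : 1 ≤ x i) (hyi : 1 ≤ y i) :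
    tupleTilde S x i = tupleTilde S y i ↔ (x i = m ↔ y i = m) := by
  have hxm := le_tupleMax (x := x) hi
  have hym := le_tupleMax (x := y) hi
  unfold tupleTilde
  split_ifs <;> omega

theorem RightLex.asymm (h : RightLex S x y) : ¬ RightLex S y x := by
  rintro ⟨j, hj, hj_eq, hj_lt⟩
  obtain ⟨i, hi, hi_eq, hi_lt⟩ := h
  rcases lt_trichotomy i j with hij | rfl | hij
  · exact hj_lt.ne (hi_eq j hj hij).symm
  · exact hi_lt.asymm hj_lt
  · exact hi_lt.ne (hj_eq i hi hij).symm

theorem PrecOn.tupleMax_le (h : PrecOn x y S) : tupleMax S x ≤ tupleMax S y := by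
  cases h with
  | max_lt _ hmax => exact hmax.le
  | tilde_lt _ hmax _ => exact hmax.le
  | star_lt _ hmax _ _ _ => exact hmax.le

theorem PrecOn.exists_lt (h : PrecOn x y S) : ∃ i ∈ S, x i < y i := by
  induction h with
  | max_lt S hmax =>
    by_contra! hle
    exact hmax.not_ge (Finset.sup_le fun i hi => (hle i hi).trans (le_tupleMax hi))
  | tilde_lt S hmax hlex =>
    obtain ⟨i, hi, -, hlt⟩ := hlex
    have hxi := le_tupleMax (x := x) hi
    refine ⟨i, hi, ?_⟩
    unfold tupleTilde at hlt
    split_ifs at hlt <;> omega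
  | star_lt S _ _ _ _ ih =>
    obtain ⟨i, hi, hlt⟩ := ih
    exact ⟨i, filter_subset _ _ hi, hlt⟩

theorem filter_lt_tupleMax_eq (hmax : tupleMax S x = tupleMax S y) (hone : 1 < tupleMax S x)
    (htilde : ∀ i ∈ S, tupleTilde S x i = tupleTilde S y i) :
    {i ∈ S | x i < tupleMax S x} = {i ∈ S | y i < tupleMax S y} := by
  refine filter_congr fun i hi => ?_
  have hxi := le_tupleMax (x := x) hi
  have hyi := le_tupleMax (x := y) hi
  have heq := htilde i hi
  unfold tupleTilde at heq
  split_ifs at heq <;> omega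

theorem PrecOn.asymm (h : PrecOn x y S) : ¬ PrecOn y x S := by
  induction h with
  | max_lt S hmax => exact fun h => hmax.not_ge h.tupleMax_le
  | tilde_lt S hmax hlex =>
    rintro (⟨_, h⟩ | ⟨_, _, h⟩ | ⟨_, _, _, h, _⟩)
    · omega
    · exact hlex.asymm h
    · obtain ⟨i, hi, -, hlt⟩ := hlex
      exact hlt.ne (h i hi).symm
  | star_lt S hmax htwo htilde _ ih =>
    rintro (⟨_, h⟩ | ⟨_, _, h⟩ | ⟨_, _, _, _, h⟩)
    · omega
    · obtain ⟨i, hi, -, hlt⟩ := h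
      exact hlt.ne (htilde i hi).symm
    · exact ih (filter_lt_tupleMax_eq hmax (by omega) htilde ▸ h)

theorem exists_last_eq {i : Fin d} (hi : i ∈ S) (hyi : y i = m) :
    ∃ l ∈ S, y l = m ∧ i ≤ l ∧ ∀ j ∈ S, l < j → y j ≠ m := by
  obtain ⟨l, hl, hmax⟩ := exists_max_image {j ∈ S | y j = m} id ⟨i, mem_filter.2 ⟨hi, hyi⟩⟩
  obtain ⟨hlS, hlm⟩ := mem_filter.1 hl
  exact ⟨l, hlS, hlm, hmax i (mem_filter.2 ⟨hi, hyi⟩), fun j hj hlj hym =>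
    hlj.not_ge (hmax j (mem_filter.2 ⟨hj, hym⟩))⟩

theorem precOn_iff_of_tupleMax_eq (hx : ∀ j ∈ S, 1 ≤ x j) (hy : ∀ j ∈ S, 1 ≤ y j)
    (hxm : tupleMax S x = m) (hym : tupleMax S y = m) :
    PrecOn x y S ↔
      (∃ i ∈ S, x i < m ∧ y i = m ∧ ∀ j ∈ S, i < j → (x j = m ↔ y j = m)) ∨
      (∀ j ∈ S, x j = m ↔ y j = m) ∧ PrecOn x y {j ∈ S | x j < m} := by
  constructor
  · rintro (⟨_, hlt⟩ | ⟨_, _, i, hi, heq, hlt⟩ | ⟨_, _, _, heq, hstar⟩)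
    · omega
    · obtain ⟨hxi, hyi⟩ := (tupleTilde_lt_iff hxm hym hi (hx i hi)).1 hlt
      exact .inl ⟨i, hi, hxi, hyi, fun j hj hij =>
        (tupleTilde_eq_iff hxm hym hj (hx j hj) (hy j hj)).1 (heq j hj hij)⟩
    · exact .inr ⟨fun j hj => (tupleTilde_eq_iff hxm hym hj (hx j hj) (hy j hj)).1 (heq j hj),
        hxm ▸ hstar⟩
  · rintro (⟨i, hi, hxi, hyi, heq⟩ | ⟨heq, hstar⟩)
    · exact .tilde_lt S (hxm.trans hym.symm)
        ⟨i, hi, fun j hj hij => (tupleTilde_eq_iff hxm hym hj (hx j hj) (hy j hj)).2 (heq j hj hij),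
          (tupleTilde_lt_iff hxm hym hi (hx i hi)).2 ⟨hxi, hyi⟩⟩
    · obtain ⟨i, hi, hlt⟩ := hstar.exists_lt
      obtain ⟨hiS, him⟩ := mem_filter.1 hi
      have hxi := hx i hiS
      have hyi := le_tupleMax (x := y) hiS
      have htwo : 2 < m := by have := heq i hiS; omega
      exact .star_lt S (hxm.trans hym.symm) (htwo.trans_eq hxm.symm)
        (fun j hj => (tupleTilde_eq_iff hxm hym hj (hx j hj) (hy j hj)).2 (heq j hj))
        (hxm.symm ▸ hstar)

/-- The common upper bound `m` need not be attained, which makes the recursion applicable to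
subtuples without recomputing their maxima. -/
theorem precOn_iff_of_le (hx : ∀ j ∈ S, 1 ≤ x j) (hy : ∀ j ∈ S, 1 ≤ y j)
    (hxm : ∀ j ∈ S, x j ≤ m) (hym : ∀ j ∈ S, y j ≤ m) :
    PrecOn x y S ↔
      (∃ i ∈ S, x i < m ∧ y i = m ∧ ∀ j ∈ S, i < j → (x j = m ↔ y j = m)) ∨
      (∀ j ∈ S, x j = m ↔ y j = m) ∧ PrecOn x y {j ∈ S | x j < m} := by
  by_cases hxa : ∃ i ∈ S, x i = m
  · obtain ⟨i, hi, him⟩ := hxa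
    have hxmax := tupleMax_eq hi him hxm
    by_cases hya : ∃ i ∈ S, y i = m
    · obtain ⟨k, hk, hkm⟩ := hya
      exact precOn_iff_of_tupleMax_eq hx hy hxmax (tupleMax_eq hk hkm hym)
    · push Not at hya
      have hlt : tupleMax S y < m := (Finset.sup_lt_iff (by have := hx i hi; simp; omega)).2
        fun j hj => (hym j hj).lt_of_ne (hya j hj)
      refine iff_of_false (fun h => hlt.not_ge (hxmax ▸ h.tupleMax_le)) ?_
      rintro (⟨k, hk, -, hkm, -⟩ | ⟨heq, -⟩)
      · exact hya k hk hkm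
      · exact hya i hi ((heq i hi).1 him)
  · push Not at hxa
    have hxlt : ∀ j ∈ S, x j < m := fun j hj => (hxm j hj).lt_of_ne (hxa j hj)
    by_cases hya : ∃ i ∈ S, y i = m
    · obtain ⟨k, hk, hkm⟩ := hya
      obtain ⟨l, hl, hlm, -, hlast⟩ := exists_last_eq hk hkm
      have hpos : ⊥ < m := (hx k hk).trans_lt (hxlt k hk) |>.trans_le' (by simp)
      refine iff_of_true (.max_lt S ?_) (.inl ⟨l, hl, hxlt l hl, hlm, fun j hj hlj =>
        iff_of_false (hxa j hj) (hlast j hj hlj)⟩)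
      rw [tupleMax_eq hk hkm hym]
      exact (Finset.sup_lt_iff hpos).2 hxlt
    · push Not at hya
      rw [filter_true_of_mem hxlt, and_iff_right fun j hj => iff_of_false (hxa j hj) (hya j hj)]
      exact ⟨.inr, fun h => h.resolve_left fun ⟨i, hi, _, him, _⟩ => hya i hi him⟩

theorem PrecOn.of_last {i : Fin d} (hx : ∀ j ∈ S, 1 ≤ x j) (hy : ∀ j ∈ S, 1 ≤ y j)
    (hxm : ∀ j ∈ S, x j ≤ m) (hym : ∀ j ∈ S, y j ≤ m) (hi : i ∈ S) (hxi : x i < m) (hyi : y i = m)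
    (hlast : ∀ j ∈ S, i < j → (x j = m ↔ y j = m)) : PrecOn x y S :=
  (precOn_iff_of_le hx hy hxm hym).2 (.inl ⟨i, hi, hxi, hyi, hlast⟩)

theorem PrecOn.of_erase {t : Fin d} (hx : ∀ j ∈ S, 1 ≤ x j) (hy : ∀ j ∈ S, 1 ≤ y j)
    (hxm : ∀ j ∈ S, x j ≤ m) (hym : ∀ j ∈ S, y j ≤ m) (hxt : x t = m) (hyt : y t = m)
    (h : PrecOn x y (S.erase t)) : PrecOn x y S := by
  have hsub : ∀ j ∈ S.erase t, j ∈ S := fun _ => mem_of_mem_erase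
  have hiff : ∀ j ∈ S, (j ∈ S.erase t → (x j = m ↔ y j = m)) → (x j = m ↔ y j = m) := by
    intro j hj hjt
    by_cases h : j = t
    · exact h ▸ iff_of_true hxt hyt
    · exact hjt (mem_erase.2 ⟨h, hj⟩)
  have hfilter : {j ∈ S.erase t | x j < m} = {j ∈ S | x j < m} := by
    rw [filter_erase, erase_eq_of_notMem fun hmem => (mem_filter.1 hmem).2.ne hxt]
  rw [precOn_iff_of_le hx hy hxm hym]
  rw [precOn_iff_of_le (fun j hj => hx j (hsub j hj)) (fun j hj => hy j (hsub j hj))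
    (fun j hj => hxm j (hsub j hj)) (fun j hj => hym j (hsub j hj)), hfilter] at h
  rcases h with ⟨i, hi, hxi, hyi, hlast⟩ | ⟨heq, hstar⟩
  · exact .inl ⟨i, hsub i hi, hxi, hyi, fun j hj hij => hiff j hj fun hj => hlast j hj hij⟩
  · exact .inr ⟨fun j hj => hiff j hj (heq j), hstar⟩

theorem IsFirstString.unique {n : ℕ} {F F' : Set (Fin d → ℕ)} (h : IsFirstString n F)
    (h' : IsFirstString n F') : F = F' := by
  obtain ⟨hpos, hcard, hfirst⟩ := h
  obtain ⟨hpos', hcard', hfirst'⟩ := h'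
  by_contra hne
  obtain ⟨x, hx, hxn⟩ : ∃ x ∈ F, x ∉ F' := by
    by_contra! hsub
    exact hne ((Set.finite_of_encard_eq_coe hcard').eq_of_subset_of_encard_le' hsub
      (by rw [hcard, hcard']))
  obtain ⟨y, hy, hyn⟩ : ∃ y ∈ F', y ∉ F := by
    by_contra! hsub
    exact hne ((Set.finite_of_encard_eq_coe hcard).eq_of_subset_of_encard_le' hsub
      (by rw [hcard, hcard'])).symm
  exact (hfirst x hx y (hpos' y hy) hyn).asymm (hfirst' y hy x (hpos x hx) hxn)

end Order

/-! ### Daisies in coordinate planes -/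

section Daisy

variable {d : ℕ}

/-- The DO1 tuple with values `c + 2` before `t` and `c + 1` from `t` on. Restricted to index sets
containing `t` these are all the DO1 tuples, and `t` is the value-change position. -/
def stepTuple (c : ℕ) (t : Fin d) : Fin d → ℕ :=
  fun j => if j < t then c + 2 else c + 1

/-- The tuple `stepTuple c t` with the entry at the value-change position raised by one, which is
the next DO1 tuple. -/
def growTuple (c : ℕ) (t : Fin d) : Fin d → ℕ :=
  fun j => if j ≤ t then c + 2 else c + 1

theorem stepTuple_of_lt {c : ℕ} {t j : Fin d} (h : j < t) : stepTuple c t j = c + 2 :=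
  if_pos h

theorem stepTuple_of_le {c : ℕ} {t j : Fin d} (h : t ≤ j) : stepTuple c t j = c + 1 :=
  if_neg h.not_gt

theorem growTuple_self (c : ℕ) (t : Fin d) : growTuple c t t = c + 2 :=
  if_pos le_rfl

theorem growTuple_of_lt {c : ℕ} {t j : Fin d} (h : t < j) : growTuple c t j = c + 1 :=
  if_neg h.not_ge

theorem stepTuple_antitone (c : ℕ) (t : Fin d) : Antitone (stepTuple c t) := by
  intro i j hij
  unfold stepTuple
  split_ifs <;> omega

theorem one_le_stepTuple (c : ℕ) (t j : Fin d) : 1 ≤ stepTuple c t j := by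
  unfold stepTuple
  split_ifs <;> omega

theorem growTuple_le (c : ℕ) (t j : Fin d) : growTuple c t j ≤ c + 2 := by
  unfold growTuple
  split_ifs <;> omega

theorem growTuple_of_ne {c : ℕ} {t j : Fin d} (h : j ≠ t) : growTuple c t j = stepTuple c t j := by
  simp only [growTuple, stepTuple, h.le_iff_lt]

theorem stepTuple_le_growTuple (c : ℕ) (t : Fin d) : stepTuple c t ≤ growTuple c t := by
  intro j
  rcases eq_or_ne j t with rfl | h
  · simp [stepTuple, growTuple]
  · exact (growTuple_of_ne h).ge

theorem growTuple_le_stepTuple {c c' : ℕ} {t t' i : Fin d}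
    (hlt : stepTuple c' t' i < stepTuple c t i) : growTuple c' t' ≤ stepTuple c t := by
  intro j
  simp only [stepTuple, growTuple] at hlt ⊢
  split_ifs at hlt ⊢ <;> omega

/-- The box with sides `{1, …, q j}`, `j ∈ S`, in the coordinate plane through `z` with
directions `S`. -/
def boxOn (S : Finset (Fin d)) (z q : Fin d → ℕ) : Finset (Fin d → ℕ) :=
  Fintype.piFinset fun j => if j ∈ S then Icc 1 (q j) else {z j}

/-- `DaisyOn S z c t C` says that `C` is a daisy in the coordinate plane through `z` with directions
`S`, the sides of whose largest box are given by `stepTuple c t`; the smaller boxes form a daisy in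
the facet adjacent to that box in the direction `t`. -/
inductive DaisyOn : Finset (Fin d) → (Fin d → ℕ) → ℕ → Fin d → Finset (Fin d → ℕ) → Prop
  | box (S : Finset (Fin d)) (z : Fin d → ℕ) (c : ℕ) (t : Fin d) (ht : t ∈ S) :
      DaisyOn S z c t (boxOn S z (stepTuple c t))
  | cons (S : Finset (Fin d)) (z : Fin d → ℕ) (c : ℕ) (t : Fin d) (ht : t ∈ S)
      (c' : ℕ) (t' : Fin d) (C : Finset (Fin d → ℕ))
      (hC : DaisyOn (S.erase t) (update z t (c + 2)) c' t' C)
      (hlt : ∃ j ∈ S.erase t, stepTuple c' t' j < stepTuple c t j) :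
      DaisyOn S z c t (boxOn S z (stepTuple c t) ∪ C)

variable {S : Finset (Fin d)} {z q x y : Fin d → ℕ} {c : ℕ} {t : Fin d} {C : Finset (Fin d → ℕ)}

theorem mem_boxOn : x ∈ boxOn S z q ↔ (∀ j ∈ S, 1 ≤ x j ∧ x j ≤ q j) ∧ ∀ j ∉ S, x j = z j := by
  rw [boxOn, Fintype.mem_piFinset, ← forall_and]
  refine forall_congr' fun j => ?_
  by_cases hj : j ∈ S <;> simp [hj]

theorem card_boxOn (S : Finset (Fin d)) (z q : Fin d → ℕ) : #(boxOn S z q) = ∏ j ∈ S, q j := by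
  rw [boxOn, Fintype.card_piFinset, ← prod_subset (subset_univ S) fun j _ hj => by simp [hj]]
  exact prod_congr rfl fun j hj => by simp [hj]

theorem boxOn_mono {q' : Fin d → ℕ} (h : q ≤ q') : boxOn S z q ⊆ boxOn S z q' := by
  intro x hx
  rw [mem_boxOn] at hx ⊢
  exact ⟨fun j hj => ⟨(hx.1 j hj).1, (hx.1 j hj).2.trans (h j)⟩, hx.2⟩

theorem forall_notMem_erase_eq_update_iff (ht : t ∈ S) (v : ℕ) :
    (∀ j ∉ S.erase t, x j = update z t v j) ↔ x t = v ∧ ∀ j ∉ S, x j = z j := by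
  have hne : ∀ j ∉ S, j ≠ t := fun j hj => (ne_of_mem_of_not_mem ht hj).symm
  constructor
  · intro hx
    refine ⟨by simpa using hx t (notMem_erase t S), fun j hj => ?_⟩
    rw [hx j fun h => hj (mem_of_mem_erase h), update_of_ne (hne j hj)]
  · rintro ⟨hxt, hx⟩ j hj
    rcases eq_or_ne j t with rfl | hjt
    · rw [update_self, hxt]
    · rw [update_of_ne hjt, hx j fun hjS => hj (mem_erase.2 ⟨hjt, hjS⟩)]

theorem mem_boxOn_iff_mem_boxOn_erase (ht : t ∈ S) :
    x ∈ boxOn S z q ↔ (1 ≤ x t ∧ x t ≤ q t) ∧ x ∈ boxOn (S.erase t) (update z t (x t)) q := by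
  have hS : (∀ j ∈ S, 1 ≤ x j ∧ x j ≤ q j) ↔
      (1 ≤ x t ∧ x t ≤ q t) ∧ ∀ j ∈ S.erase t, 1 ≤ x j ∧ x j ≤ q j := by
    conv_lhs => rw [← insert_erase ht, forall_mem_insert]
  rw [mem_boxOn, mem_boxOn, forall_notMem_erase_eq_update_iff ht, hS, and_assoc,
    and_iff_right (rfl : x t = x t)]

theorem update_mem_boxOn_erase {v : ℕ} (hx : x ∈ boxOn (S.erase t) (update z t v) q) (k : ℕ) :
    update x t k ∈ boxOn (S.erase t) (update z t k) q := by
  rw [mem_boxOn] at hx ⊢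
  refine ⟨fun j hj => ?_, fun j hj => ?_⟩
  · rw [update_of_ne (ne_of_mem_erase hj)]
    exact hx.1 j hj
  · rcases eq_or_ne j t with rfl | hjt
    · rw [update_self, update_self]
    · rw [update_of_ne hjt, update_of_ne hjt, hx.2 j hj, update_of_ne hjt]

theorem update_mem_boxOn {k v : ℕ} (ht : t ∈ S) (hx : x ∈ boxOn (S.erase t) (update z t v) q)
    (hk : 1 ≤ k) (hkq : k ≤ q t) : update x t k ∈ boxOn S z q := by
  rw [mem_boxOn_iff_mem_boxOn_erase ht, update_self]
  exact ⟨⟨hk, hkq⟩, update_mem_boxOn_erase hx k⟩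

theorem boxOn_erase_subset_boxOn {k : ℕ} (ht : t ∈ S) (hk : 1 ≤ k) (hkq : k ≤ q t) :
    boxOn (S.erase t) (update z t k) q ⊆ boxOn S z q := by
  intro x hx
  have hxt : x t = k := by simpa using (mem_boxOn.1 hx).2 t (notMem_erase t S)
  subst hxt
  exact (mem_boxOn_iff_mem_boxOn_erase ht).2 ⟨⟨hk, hkq⟩, hx⟩

theorem DaisyOn.subset_boxOn_growTuple (h : DaisyOn S z c t C) :
    C ⊆ boxOn S z (growTuple c t) := by
  induction h with
  | box S z c t _ => exact boxOn_mono (stepTuple_le_growTuple c t)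
  | cons S z c t ht c' t' C _ hlt ih =>
    obtain ⟨i, -, hi⟩ := hlt
    refine union_subset (boxOn_mono (stepTuple_le_growTuple c t)) (ih.trans ?_)
    exact (boxOn_mono ((growTuple_le_stepTuple hi).trans (stepTuple_le_growTuple c t))).trans
      (boxOn_erase_subset_boxOn ht (by omega) (growTuple_self c t).ge)

theorem DaisyOn.subset_boxOn_of_lt {c₀ : ℕ} {t₀ : Fin d} (h : DaisyOn S z c t C)
    (hlt : ∃ j ∈ S, stepTuple c t j < stepTuple c₀ t₀ j) : C ⊆ boxOn S z (stepTuple c₀ t₀) := by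
  obtain ⟨i, -, hi⟩ := hlt
  exact h.subset_boxOn_growTuple.trans (boxOn_mono (growTuple_le_stepTuple hi))

theorem DaisyOn.boxOn_subset (h : DaisyOn S z c t C) : boxOn S z (stepTuple c t) ⊆ C := by
  cases h
  · exact subset_rfl
  · exact subset_union_left

theorem DaisyOn.eq_of_mem {i : Fin d} (h : DaisyOn S z c t C) (hx : x ∈ C) (hi : i ∉ S) :
    x i = z i :=
  (mem_boxOn.1 (h.subset_boxOn_growTuple hx)).2 i hi

theorem DaisyOn.eq_of_mem_erase {k : ℕ} {c' : ℕ} {t' : Fin d}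
    (h : DaisyOn (S.erase t) (update z t k) c' t' C) (hx : x ∈ C) : x t = k := by
  simpa using h.eq_of_mem hx (notMem_erase t S)

theorem precOn_or_of_notMem_boxOn (hx : x ∈ boxOn S z (growTuple c t)) (hy : ∀ j ∈ S, 1 ≤ y j)
    (hyz : ∀ j ∉ S, y j = z j) (hyn : y ∉ boxOn S z (stepTuple c t)) :
    PrecOn x y S ∨ x t = c + 2 ∧ y t = c + 2 ∧ ∀ j ∈ S, y j ≤ c + 2 := by
  obtain ⟨hxS, -⟩ := mem_boxOn.1 hx
  have hxm : ∀ j ∈ S, x j ≤ c + 2 := fun j hj => (hxS j hj).2.trans (growTuple_le c t j)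
  by_cases hym : ∀ j ∈ S, y j ≤ c + 2
  · obtain ⟨i, hi, hiy⟩ : ∃ i ∈ S, stepTuple c t i < y i := by
      by_contra! hle
      exact hyn (mem_boxOn.2 ⟨fun j hj => ⟨hy j hj, hle j hj⟩, hyz⟩)
    have hyi := hym i hi
    have hti : t ≤ i := by
      by_contra! hlt
      rw [stepTuple_of_lt hlt] at hiy
      omega
    rw [stepTuple_of_le hti] at hiy
    obtain ⟨l, hl, hyl, hil, hlast⟩ := exists_last_eq hi (by omega : y i = c + 2)
    have hxlt : ∀ j ∈ S, t < j → x j < c + 2 := fun j hj htj => by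
      have := (hxS j hj).2
      rw [growTuple_of_lt htj] at this
      omega
    rcases (hxm l hl).lt_or_eq with hxl | hxl
    · exact .inl (PrecOn.of_last (fun j hj => (hxS j hj).1) hy hxm hym hl hxl hyl fun j hj hlj =>
        iff_of_false (hxlt j hj ((hti.trans hil).trans_lt hlj)).ne (hlast j hj hlj))
    · obtain rfl : t = l := (hti.trans hil).eq_of_not_lt fun htl => (hxlt l hl htl).ne hxl
      exact .inr ⟨hxl, hyl, hym⟩
  · push Not at hym
    obtain ⟨i, hi, hiy⟩ := hym
    exact .inl (.max_lt S ((Finset.sup_le hxm).trans_lt (hiy.trans_le (le_tupleMax hi))))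

theorem DaisyOn.precOn (h : DaisyOn S z c t C) (hx : x ∈ C) (hy : ∀ j ∈ S, 1 ≤ y j)
    (hyz : ∀ j ∉ S, y j = z j) (hyn : y ∉ C) : PrecOn x y S := by
  induction h with
  | box S z c t ht =>
    refine (precOn_or_of_notMem_boxOn (boxOn_mono (stepTuple_le_growTuple c t) hx) hy hyz
      hyn).resolve_right ?_
    rintro ⟨hxt, -⟩
    have := ((mem_boxOn.1 hx).1 t ht).2
    rw [stepTuple_of_le le_rfl] at this
    omega
  | cons S z c t ht c' t' C hC hlt ih =>
    have hhull := (DaisyOn.cons S z c t ht c' t' C hC hlt).subset_boxOn_growTuple hx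
    rw [mem_union, not_or] at hyn
    rcases precOn_or_of_notMem_boxOn hhull hy hyz hyn.1 with h | ⟨hxt, hyt, hym⟩
    · exact h
    obtain ⟨hxS, -⟩ := mem_boxOn.1 hhull
    have hxC : x ∈ C := (mem_union.1 hx).resolve_left fun hxbox => by
      have := ((mem_boxOn.1 hxbox).1 t ht).2
      rw [stepTuple_of_le le_rfl] at this
      omega
    refine PrecOn.of_erase (fun j hj => (hxS j hj).1) hy
      (fun j hj => (hxS j hj).2.trans (growTuple_le c t j)) hym hxt hyt
      (ih hxC (fun j hj => hy j (mem_of_mem_erase hj)) (fun j hj => ?_) hyn.2)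
    rcases eq_or_ne j t with rfl | hjt
    · rw [hyt, update_self]
    · rw [update_of_ne hjt]
      exact hyz j fun hjS => hj (mem_erase.2 ⟨hjt, hjS⟩)

theorem update_mem_boxOn_of_le {i : Fin d} {k : ℕ} (hi : i ∈ S) (hx : x ∈ boxOn S z q)
    (hk : 1 ≤ k) (hkx : k ≤ x i) : update x i k ∈ boxOn S z q := by
  obtain ⟨⟨-, hxq⟩, hx⟩ := (mem_boxOn_iff_mem_boxOn_erase hi).1 hx
  exact update_mem_boxOn hi hx hk (hkx.trans hxq)

theorem DaisyOn.update_mem {i : Fin d} {k : ℕ} (h : DaisyOn S z c t C) (hx : x ∈ C) (hi : i ∈ S)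
    (hk : 1 ≤ k) (hkx : k ≤ x i) : update x i k ∈ C := by
  induction h with
  | box S z c t _ => exact update_mem_boxOn_of_le hi hx hk hkx
  | cons S z c t ht c' t' C hC hlt ih =>
    rw [mem_union] at hx ⊢
    rcases hx with hx | hx
    · exact .inl (update_mem_boxOn_of_le hi hx hk hkx)
    rcases eq_or_ne i t with rfl | hit
    · rw [hC.eq_of_mem_erase hx] at hkx
      rcases hkx.lt_or_eq with hlt' | rfl
      · refine .inl (update_mem_boxOn hi (hC.subset_boxOn_of_lt hlt hx) hk ?_)
        rw [stepTuple_of_le le_rfl]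
        omega
      · rw [← hC.eq_of_mem_erase hx, update_eq_self]
        exact .inr hx
    · exact .inr (ih hx (mem_erase.2 ⟨hit, hi⟩))

end Daisy

/-! ### Daisies of given cardinality -/

theorem exists_card_filter_lt_eq {α : Type*} [LinearOrder α] (S : Finset α) {a : ℕ} (ha : a < #S) :
    ∃ t ∈ S, #{i ∈ S | i < t} = a := by
  induction S using Finset.induction_on_max with
  | empty => simp at ha
  | insert m S hm ih =>
    rw [card_insert_of_notMem fun hmS => (hm m hmS).false, Nat.lt_succ_iff_lt_or_eq] at ha
    rcases ha with ha | rfl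
    · obtain ⟨t, ht, hcard⟩ := ih ha
      exact ⟨t, mem_insert_of_mem ht, by rwa [filter_insert, if_neg (hm t ht).not_gt]⟩
    · refine ⟨m, mem_insert_self m S, ?_⟩
      rw [filter_insert, if_neg (lt_irrefl m), filter_true_of_mem hm]

section DaisyCard

variable {d : ℕ}

/-- The position of the box with sides `stepTuple c t j`, `j ∈ S`, in the chain of boxes. -/
def stepIndex (S : Finset (Fin d)) (c : ℕ) (t : Fin d) : ℕ :=
  #S * c + #{i ∈ S | i < t}

variable {S : Finset (Fin d)} {z q x : Fin d → ℕ} {c : ℕ} {t : Fin d} {C : Finset (Fin d → ℕ)}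

theorem prod_stepTuple (S : Finset (Fin d)) (c : ℕ) (t : Fin d) :
    ∏ j ∈ S, stepTuple c t j = (c + 2) ^ #{i ∈ S | i < t} * (c + 1) ^ (#S - #{i ∈ S | i < t}) := by
  have hcard := card_filter_add_card_filter_not (s := S) (· < t)
  simp only [stepTuple]
  rw [prod_ite, prod_const, prod_const, ← hcard, Nat.add_sub_cancel_left]

theorem prod_stepTuple_eq_boxSize (S : Finset (Fin d)) (c : ℕ) (t : Fin d) :
    ∏ j ∈ S, stepTuple c t j = boxSize #S (stepIndex S c t) := by
  rw [prod_stepTuple, stepIndex, boxSize_mul_add c (card_filter_le _ _)]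

theorem filter_erase_lt (S : Finset (Fin d)) (t : Fin d) :
    {i ∈ S.erase t | i < t} = {i ∈ S | i < t} := by
  rw [filter_erase, erase_eq_of_notMem]
  exact fun h => lt_irrefl t (mem_filter.1 h).2

theorem stepIndex_erase (ht : t ∈ S) :
    stepIndex (S.erase t) c t = facetIndex #(S.erase t) (stepIndex S c t) := by
  have hlt : #{i ∈ S | i < t} ≤ #(S.erase t) := filter_erase_lt S t ▸ card_filter_le _ _
  rw [stepIndex, stepIndex, filter_erase_lt, ← card_erase_add_one ht, facetIndex_mul_add c hlt]

theorem sum_prod_erase_stepTuple (S : Finset (Fin d)) (c : ℕ) (t : Fin d) :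
    ∑ i ∈ S, ∏ j ∈ S.erase i, stepTuple c t j = boxShadow #S (stepIndex S c t) := by
  have hcard := card_filter_add_card_filter_not (s := S) (· < t)
  rw [stepIndex, boxShadow_mul_add c (card_filter_le _ _),
    ← sum_filter_add_sum_filter_not S (· < t)]
  congr 1
  · refine sum_eq_card_nsmul fun i hi => ?_
    rw [prod_stepTuple, filter_erase, card_erase_of_mem hi, card_erase_of_mem (mem_filter.1 hi).1,
      Nat.sub_sub_sub_cancel_right (card_pos.2 ⟨i, hi⟩)]
  · rw [show #S - #{i ∈ S | i < t} = #{i ∈ S | ¬i < t} by omega]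
    refine sum_eq_card_nsmul fun i hi => ?_
    obtain ⟨hiS, hit⟩ := mem_filter.1 hi
    have hi' : i ∉ {l ∈ S | l < t} := fun h => hit (mem_filter.1 h).2
    rw [prod_stepTuple, filter_erase, erase_eq_of_notMem hi', card_erase_of_mem hiS]
    congr 2
    omega

theorem exists_eq_prod_stepTuple_add (hS : S.Nonempty) {n : ℕ} (hn : n ≠ 0) :
    ∃ c, ∃ t ∈ S, ∃ r < ∏ j ∈ S.erase t, stepTuple c t j, n = ∏ j ∈ S, stepTuple c t j + r := by
  obtain ⟨D, hD⟩ := Nat.exists_eq_add_of_le' hS.card_pos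
  obtain ⟨u, r, hr, rfl⟩ := exists_eq_boxSize_add D hn
  obtain ⟨c, a, ha, rfl⟩ := exists_eq_mul_add D u
  obtain ⟨t, ht, rfl⟩ := exists_card_filter_lt_eq S (show a < #S by omega)
  refine ⟨c, t, ht, r, ?_, ?_⟩
  · rwa [prod_stepTuple_eq_boxSize, stepIndex_erase ht, stepIndex, card_erase_of_mem ht, hD]
  · rw [prod_stepTuple_eq_boxSize, stepIndex, hD]

theorem DaisyOn.card_union {k c' : ℕ} {t' : Fin d} (ht : t ∈ S) (hk : q t < k)
    (h : DaisyOn (S.erase t) (update z t k) c' t' C) :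
    #(boxOn S z q ∪ C) = ∏ j ∈ S, q j + #C := by
  rw [card_union_of_disjoint, card_boxOn]
  refine disjoint_left.2 fun x hx hxC => ?_
  have hxt := ((mem_boxOn.1 hx).1 t ht).2
  rw [h.eq_of_mem_erase hxC] at hxt
  omega

theorem exists_daisyOn_card (hS : S.Nonempty) (z : Fin d → ℕ) {n : ℕ} (hn : n ≠ 0) :
    ∃ c t C, DaisyOn S z c t C ∧ #C = n := by
  induction S using Finset.strongInduction generalizing z n with
  | H S ih =>
    obtain ⟨c, t, ht, r, hr, rfl⟩ := exists_eq_prod_stepTuple_add hS hn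
    rcases eq_or_ne r 0 with rfl | hr0
    · exact ⟨c, t, _, .box S z c t ht, card_boxOn _ _ _⟩
    have hne : (S.erase t).Nonempty := by
      rw [nonempty_iff_ne_empty]
      intro he
      rw [he, prod_empty] at hr
      omega
    obtain ⟨c', t', C, hC, rfl⟩ := ih (S.erase t) (erase_ssubset ht) hne (update z t (c + 2)) hr0
    have hprod := (card_boxOn _ _ _).symm.trans_le (card_le_card hC.boxOn_subset)
    exact ⟨c, t, _, .cons S z c t ht c' t' C hC (exists_lt_of_prod_lt' (hprod.trans_lt hr)),
      hC.card_union ht (by rw [stepTuple_of_le le_rfl]; omega)⟩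

theorem axisShadow_boxOn_subset {i : Fin d} (hi : i ∈ S) :
    axisShadow i (boxOn S z q) ⊆ boxOn (S.erase i) (update z i 0) q := by
  refine image_subset_iff.2 fun x hx => ?_
  exact update_mem_boxOn_erase ((mem_boxOn_iff_mem_boxOn_erase hi).1 hx).2 0

theorem shadowSum_boxOn_le (S : Finset (Fin d)) (z q : Fin d → ℕ) :
    shadowSum S (boxOn S z q) ≤ ∑ i ∈ S, ∏ j ∈ S.erase i, q j :=
  sum_le_sum fun _ hi =>
    (card_le_card (axisShadow_boxOn_subset hi)).trans_eq (card_boxOn _ _ _)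

theorem axisShadow_union (i : Fin d) (B C : Finset (Fin d → ℕ)) :
    axisShadow i (B ∪ C) = axisShadow i B ∪ axisShadow i C :=
  image_union B C

theorem shadowSum_union_le {B : Finset (Fin d → ℕ)} (ht : t ∈ S)
    (h : axisShadow t C ⊆ axisShadow t B) :
    shadowSum S (B ∪ C) ≤ shadowSum S B + shadowSum (S.erase t) C := by
  unfold shadowSum
  rw [← add_sum_erase S _ ht, ← add_sum_erase S _ ht, add_assoc, ← sum_add_distrib]
  refine add_le_add ?_ (sum_le_sum fun j _ => ?_)
  · rw [axisShadow_union, union_eq_left.2 h]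
  · rw [axisShadow_union]
    exact card_union_le _ _

theorem axisShadow_subset_of_subset_boxOn_erase {k : ℕ} (ht : t ∈ S) (hq : 1 ≤ q t)
    (hC : C ⊆ boxOn (S.erase t) (update z t k) q) :
    axisShadow t C ⊆ axisShadow t (boxOn S z q) := by
  refine image_subset_iff.2 fun x hx => mem_image.2 ⟨update x t 1, ?_, update_idem _ _ _⟩
  exact update_mem_boxOn ht (hC hx) le_rfl hq

theorem shadowSum_boxOn_stepTuple_le (ht : t ∈ S) (z : Fin d → ℕ) (c : ℕ) :
    shadowSum S (boxOn S z (stepTuple c t)) ≤ minShadow #S (boxSize #S (stepIndex S c t)) := by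
  rw [← card_erase_add_one ht, minShadow_boxSize, card_erase_add_one ht,
    ← sum_prod_erase_stepTuple]
  exact shadowSum_boxOn_le S z _

theorem DaisyOn.shadowSum_le (h : DaisyOn S z c t C) : shadowSum S C ≤ minShadow #S #C := by
  induction h with
  | box S z c t ht =>
    rw [card_boxOn, prod_stepTuple_eq_boxSize]
    exact shadowSum_boxOn_stepTuple_le ht z c
  | cons S z c t ht c' t' C hC hlt ih =>
    have hsub := hC.subset_boxOn_of_lt hlt
    have hfacet : #C ≤ boxSize #(S.erase t) (facetIndex #(S.erase t) (stepIndex S c t)) := by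
      rw [← stepIndex_erase ht, ← prod_stepTuple_eq_boxSize, ← card_boxOn _ (update z t (c + 2))]
      exact card_le_card hsub
    have hunion := shadowSum_union_le ht
      (axisShadow_subset_of_subset_boxOn_erase ht (one_le_stepTuple c t t) hsub)
    have hbox := shadowSum_boxOn_stepTuple_le ht z c
    rw [hC.card_union ht (by rw [stepTuple_of_le le_rfl]; omega), prod_stepTuple_eq_boxSize]
    rw [← card_erase_add_one ht] at hbox ⊢
    rw [minShadow_add hfacet]
    exact hunion.trans (add_le_add hbox ih)

end DaisyCard

/-! ### Step tuples and DO1 tuples -/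

section DO1

variable {d : ℕ} {S : Finset (Fin d)} {q q' : Fin d → ℕ} {t t' : Fin d}

theorem isDO1On_stepTuple (S : Finset (Fin d)) (c : ℕ) (t : Fin d) :
    IsDO1On S (stepTuple c t) := by
  refine ⟨fun i _ => one_le_stepTuple c t i, fun i _ j _ hij => stepTuple_antitone c t hij.le,
    fun i _ j hj hmin _ => ?_⟩
  have hle := stepTuple_antitone c t (hmin j hj)
  simp only [stepTuple] at hle ⊢
  split_ifs at hle ⊢ <;> omega

theorem exists_isPredIn {i : Fin d} (hi : i ∈ S) (hit : i < t) : ∃ l, IsPredIn S l t := by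
  obtain ⟨l, hl, hmax⟩ := exists_max_image {j ∈ S | j < t} id ⟨i, mem_filter.2 ⟨hi, hit⟩⟩
  exact ⟨l, mem_filter.1 hl, fun j hj => hmax j (mem_filter.2 hj)⟩

theorem isValueChange_stepTuple (ht : t ∈ S) (c : ℕ) : IsValueChange S (stepTuple c t) t := by
  by_cases h : ∃ i ∈ S, i < t
  · obtain ⟨i, hi, hit⟩ := h
    obtain ⟨l, hl⟩ := exists_isPredIn hi hit
    refine .inr ⟨fun hconst => ?_, ⟨ht, l, hl, ?_⟩, ?_⟩
    · simpa [stepTuple_of_lt hit, stepTuple_of_le le_rfl] using hconst i hi t ht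
    · rw [stepTuple_of_le le_rfl, stepTuple_of_lt hl.1.2]
      exact Nat.lt_succ_self _
    · rintro j ⟨-, k, hk, hjk⟩
      by_contra! hjt
      rw [stepTuple_of_lt hjt, stepTuple_of_lt (hk.1.2.trans hjt)] at hjk
      exact hjk.false
  · push Not at h
    refine .inl ⟨fun i hi j hj => ?_, ht, h⟩
    rw [stepTuple_of_le (h i hi), stepTuple_of_le (h j hj)]

theorem IsDO1On.exists_eq_stepTuple (hS : S.Nonempty) (hq : IsDO1On S q) :
    ∃ c, ∃ t ∈ S, ∀ j ∈ S, q j = stepTuple c t j := by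
  obtain ⟨hpos, hlt, hosc⟩ := hq
  have hfirst := S.min'_mem hS
  have hlast := S.max'_mem hS
  have hanti : ∀ i ∈ S, ∀ j ∈ S, i ≤ j → q j ≤ q i := fun i hi j hj hij =>
    hij.lt_or_eq.elim (hlt i hi j hj) fun h => h ▸ le_rfl
  have hle : ∀ j ∈ S, q j ≤ q (S.min' hS) := fun j hj => hanti _ hfirst j hj (S.min'_le j hj)
  have hge : ∀ j ∈ S, q (S.max' hS) ≤ q j := fun j hj => hanti j hj _ hlast (S.le_max' j hj)
  obtain ⟨c, hc⟩ := Nat.exists_eq_add_of_le' (hpos _ hlast)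
  have hends := hosc _ hfirst _ hlast S.min'_le S.le_max'
  rw [hc] at hge hends
  rcases hends with h | h
  · refine ⟨c, S.min' hS, hfirst, fun j hj => ?_⟩
    rw [stepTuple_of_le (S.min'_le j hj)]
    exact le_antisymm ((hle j hj).trans_eq h) (hge j hj)
  · obtain ⟨t, ht, htmin⟩ := exists_min_image {j ∈ S | q j = c + 1} id
      ⟨_, mem_filter.2 ⟨hlast, hc⟩⟩
    obtain ⟨htS, hqt⟩ := mem_filter.1 ht
    refine ⟨c, t, htS, fun j hj => ?_⟩
    rcases lt_or_ge j t with hjt | htj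
    · have hne : q j ≠ c + 1 := fun hqj => (htmin j (mem_filter.2 ⟨hj, hqj⟩)).not_gt hjt
      rw [stepTuple_of_lt hjt]
      exact le_antisymm ((hle j hj).trans_eq h) ((hge j hj).lt_of_ne' hne)
    · rw [stepTuple_of_le htj]
      exact le_antisymm ((hanti t htS j hj htj).trans_eq hqt) (hge j hj)

theorem IsValueChange.unique (h : IsValueChange S q t) (h' : IsValueChange S q t') : t = t' := by
  rcases h with ⟨hconst, h⟩ | ⟨hconst, h⟩ <;> rcases h' with ⟨hconst', h'⟩ | ⟨hconst', h'⟩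
  · exact h.unique h'
  · exact absurd hconst hconst'
  · exact absurd hconst' hconst
  · exact h.unique h'

theorem IsValueChange.congr (hq : ∀ j ∈ S, q j = q' j) (h : IsValueChange S q t) :
    IsValueChange S q' t := by
  have hconst : (∀ i ∈ S, ∀ j ∈ S, q i = q j) ↔ ∀ i ∈ S, ∀ j ∈ S, q' i = q' j :=
    forall₂_congr fun i hi => forall₂_congr fun j hj => by rw [hq i hi, hq j hj]
  have hdrop : {j | j ∈ S ∧ ∃ i, IsPredIn S i j ∧ q j < q i} =
      {j | j ∈ S ∧ ∃ i, IsPredIn S i j ∧ q' j < q' i} := by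
    ext j
    refine and_congr_right fun hj => exists_congr fun i => and_congr_right fun hi => ?_
    rw [hq j hj, hq i hi.1.1]
  unfold IsValueChange at h ⊢
  rwa [← hconst, ← hdrop]

theorem IsValueChange.mem (h : IsValueChange S q t) : t ∈ S := by
  rcases h with ⟨-, h⟩ | ⟨-, h⟩
  · exact h.1
  · exact h.1.1

theorem boxOn_congr (z : Fin d → ℕ) (h : ∀ j ∈ S, q j = q' j) : boxOn S z q = boxOn S z q' := by
  ext x
  rw [mem_boxOn, mem_boxOn]
  exact and_congr_left fun _ => forall₂_congr fun j hj => by rw [h j hj]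

end DO1

/-! ### Daisy data -/

section Data

variable {d : ℕ}

/-- The indices in `S` which remain after the removal of the first `k` members of `s`. -/
def freeIn (S : Finset (Fin d)) (s : ℕ → Fin d) (k : ℕ) : Finset (Fin d) :=
  {j ∈ S | ∀ l < k, s l ≠ j}

/-- `IsDaisyData` with the set of directions `S` in place of the set of all directions. -/
structure IsDaisyDataOn (S : Finset (Fin d)) (h : ℕ) (q : ℕ → Fin d → ℕ) (s : ℕ → Fin d) :
    Prop where
  h_lt : h < #S
  do1 : ∀ k < h + 1, IsDO1On (freeIn S s k) (q k)
  change : ∀ k < h, IsValueChange (freeIn S s k) (q k) (s k)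
  le : ∀ k < h, ∀ i ∈ freeIn S s (k + 1), q (k + 1) i ≤ q k i
  lt : ∀ k < h, ∃ i ∈ freeIn S s (k + 1), q (k + 1) i < q k i

/-- `x` belongs to the `k`-th layer of the daisy with data `q`, `s` in the coordinate plane through
`z` with directions `S`. -/
structure InLayer (S : Finset (Fin d)) (z : Fin d → ℕ) (q : ℕ → Fin d → ℕ) (s : ℕ → Fin d) (k : ℕ)
    (x : Fin d → ℕ) : Prop where
  free : ∀ j ∈ freeIn S s k, 1 ≤ x j ∧ x j ≤ q k j
  removed : ∀ l < k, x (s l) = q l (s l) + 1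
  off : ∀ j ∉ S, x j = z j

variable {S : Finset (Fin d)} {z x : Fin d → ℕ} {h k : ℕ} {q : ℕ → Fin d → ℕ} {s : ℕ → Fin d}

theorem freeIn_zero (S : Finset (Fin d)) (s : ℕ → Fin d) : freeIn S s 0 = S := by
  simp [freeIn]

theorem freeIn_succ (S : Finset (Fin d)) (s : ℕ → Fin d) (k : ℕ) :
    freeIn S s (k + 1) = freeIn (S.erase (s 0)) (fun l => s (l + 1)) k := by
  ext j
  simp only [freeIn, mem_filter, mem_erase, Nat.forall_lt_succ_left, ne_comm (a := s 0)]
  tauto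

theorem isDaisyData_iff : IsDaisyData h q s ↔ IsDaisyDataOn univ h q s := by
  constructor
  · rintro ⟨hlt, hdo, hch, hle, hls⟩
    exact ⟨by simpa using hlt, fun k hk => hdo k (Nat.le_of_lt_succ hk), hch, hle, hls⟩
  · rintro ⟨hlt, hdo, hch, hle, hls⟩
    exact ⟨by simpa using hlt, fun k hk => hdo k (Nat.lt_succ_of_le hk), hch, hle, hls⟩

theorem isDaisyDataOn_zero_iff :
    IsDaisyDataOn S 0 q s ↔ S.Nonempty ∧ IsDO1On S (q 0) := by
  constructor
  · rintro ⟨hlt, hdo, -, -, -⟩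
    exact ⟨card_pos.1 hlt, freeIn_zero S s ▸ hdo 0 zero_lt_one⟩
  · rintro ⟨hS, hdo⟩
    refine ⟨hS.card_pos, fun k hk => ?_, by simp, by simp, by simp⟩
    rwa [Nat.lt_one_iff.1 hk, freeIn_zero]

theorem isDaisyDataOn_succ_iff (hs : s 0 ∈ S) :
    IsDaisyDataOn S (h + 1) q s ↔ (IsDO1On S (q 0) ∧ IsValueChange S (q 0) (s 0) ∧
      (∀ i ∈ S.erase (s 0), q 1 i ≤ q 0 i) ∧ ∃ i ∈ S.erase (s 0), q 1 i < q 0 i) ∧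
      IsDaisyDataOn (S.erase (s 0)) h (fun k => q (k + 1)) fun k => s (k + 1) := by
  have hcard := card_erase_add_one hs
  constructor
  · rintro ⟨hlt, hdo, hch, hle, hls⟩
    rw [Nat.forall_lt_succ_left] at hdo hch hle hls
    simp only [freeIn_succ S, freeIn_zero] at hdo hch hle hls
    exact ⟨⟨hdo.1, hch.1, hle.1, hls.1⟩, by omega, hdo.2, hch.2, hle.2, hls.2⟩
  · rintro ⟨⟨hdo₀, hch₀, hle₀, hls₀⟩, hlt, hdo, hch, hle, hls⟩
    refine ⟨by omega, ?_, ?_, ?_, ?_⟩ <;> rw [Nat.forall_lt_succ_left] <;>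
      simp only [freeIn_succ S, freeIn_zero]
    · exact ⟨hdo₀, hdo⟩
    · exact ⟨hch₀, hch⟩
    · exact ⟨hle₀, hle⟩
    · exact ⟨hls₀, hls⟩

theorem inLayer_zero_iff : InLayer S z q s 0 x ↔ x ∈ boxOn S z (q 0) := by
  rw [mem_boxOn]
  constructor
  · rintro ⟨hfree, -, hoff⟩
    exact ⟨freeIn_zero S s ▸ hfree, hoff⟩
  · rintro ⟨hfree, hoff⟩
    exact ⟨(freeIn_zero S s).symm ▸ hfree, by simp, hoff⟩

theorem inLayer_succ_iff (hs : s 0 ∈ S) :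
    InLayer S z q s (k + 1) x ↔ InLayer (S.erase (s 0)) (update z (s 0) (q 0 (s 0) + 1))
      (fun k => q (k + 1)) (fun k => s (k + 1)) k x := by
  constructor
  · rintro ⟨hfree, hremoved, hoff⟩
    rw [Nat.forall_lt_succ_left] at hremoved
    rw [freeIn_succ] at hfree
    exact ⟨hfree, hremoved.2, (forall_notMem_erase_eq_update_iff hs _).2 ⟨hremoved.1, hoff⟩⟩
  · rintro ⟨hfree, hremoved, hoff⟩
    obtain ⟨hzero, hoff⟩ := (forall_notMem_erase_eq_update_iff hs _).1 hoff
    refine ⟨?_, Nat.forall_lt_succ_left.2 ⟨hzero, hremoved⟩, hoff⟩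
    rwa [freeIn_succ]

theorem exists_inLayer_succ_iff (hs : s 0 ∈ S) :
    (∃ k ≤ h + 1, InLayer S z q s k x) ↔ x ∈ boxOn S z (q 0) ∨
      ∃ k ≤ h, InLayer (S.erase (s 0)) (update z (s 0) (q 0 (s 0) + 1))
        (fun k => q (k + 1)) (fun k => s (k + 1)) k x := by
  constructor
  · rintro ⟨_ | k, hk, hx⟩
    · exact .inl (inLayer_zero_iff.1 hx)
    · exact .inr ⟨k, Nat.le_of_succ_le_succ hk, (inLayer_succ_iff hs).1 hx⟩
  · rintro (hx | ⟨k, hk, hx⟩)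
    · exact ⟨0, Nat.zero_le _, inLayer_zero_iff.2 hx⟩
    · exact ⟨k + 1, Nat.succ_le_succ hk, (inLayer_succ_iff hs).2 hx⟩

theorem IsDaisyDataOn.exists_daisyOn (hdata : IsDaisyDataOn S h q s) (z : Fin d → ℕ) :
    ∃ c t C, DaisyOn S z c t C ∧ (∀ j ∈ S, q 0 j = stepTuple c t j) ∧
      ∀ x, x ∈ C ↔ ∃ k ≤ h, InLayer S z q s k x := by
  induction h generalizing S q s z with
  | zero =>
    obtain ⟨hS, hdo⟩ := isDaisyDataOn_zero_iff.1 hdata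
    obtain ⟨c, t, ht, hq⟩ := hdo.exists_eq_stepTuple hS
    refine ⟨c, t, _, .box S z c t ht, hq, fun x => ?_⟩
    simp only [Nat.le_zero, exists_eq_left, inLayer_zero_iff, boxOn_congr z hq]
  | succ h ih =>
    have hch := hdata.change 0 (Nat.succ_pos h)
    rw [freeIn_zero] at hch
    have hs := hch.mem
    obtain ⟨⟨hdo, -, -, i, hi, hlt⟩, hrec⟩ := (isDaisyDataOn_succ_iff hs).1 hdata
    obtain ⟨c, t, ht, hq⟩ := hdo.exists_eq_stepTuple ⟨_, hs⟩
    obtain rfl : s 0 = t := (hch.congr hq).unique (isValueChange_stepTuple ht c)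
    obtain ⟨c', t', C, hC, hq', hmem⟩ := ih hrec (update z (s 0) (c + 2))
    refine ⟨c, s 0, _, .cons S z c (s 0) ht c' t' C hC ⟨i, hi, ?_⟩, hq, fun x => ?_⟩
    · rwa [← hq' i hi, ← hq i (mem_of_mem_erase hi)]
    · rw [mem_union, hmem, exists_inLayer_succ_iff hs, boxOn_congr z hq, hq _ hs,
        stepTuple_of_le le_rfl]

theorem DaisyOn.exists_isDaisyDataOn {c : ℕ} {t : Fin d} {C : Finset (Fin d → ℕ)}
    (hD : DaisyOn S z c t C) : ∃ h q s, IsDaisyDataOn S h q s ∧ q 0 = stepTuple c t ∧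
      ∀ x, x ∈ C ↔ ∃ k ≤ h, InLayer S z q s k x := by
  induction hD with
  | box S z c t ht =>
    refine ⟨0, fun _ => stepTuple c t, fun _ => t,
      isDaisyDataOn_zero_iff.2 ⟨⟨t, ht⟩, isDO1On_stepTuple S c t⟩, rfl, fun x => ?_⟩
    simp only [Nat.le_zero, exists_eq_left, inLayer_zero_iff]
  | cons S z c t ht c' t' C _ hlt ih =>
    obtain ⟨h, q, s, hdata, hq, hmem⟩ := ih
    obtain ⟨i, hi, hlti⟩ := hlt
    have hle := (stepTuple_le_growTuple c' t').trans (growTuple_le_stepTuple hlti)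
    rw [← hq] at hle hlti
    refine ⟨h + 1, fun k => Nat.casesOn k (stepTuple c t) q, fun k => Nat.casesOn k t s,
      (isDaisyDataOn_succ_iff ht).2 ⟨⟨isDO1On_stepTuple S c t, isValueChange_stepTuple ht c,
        fun j _ => hle j, i, hi, hlti⟩, hdata⟩, rfl, fun x => ?_⟩
    have hcentre : stepTuple c t t + 1 = c + 2 := by rw [stepTuple_of_le le_rfl]
    rw [mem_union, hmem, exists_inLayer_succ_iff ht, ← hcentre]
    rfl

theorem IsDaisyData.lastFree_eq (hdata : IsDaisyData h q s) {l : ℕ} (hk : k ≤ h) (hl : l < k) :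
    lastFree s (s l) k = l := by
  rw [lastFree, Nat.findGreatest_eq_iff]
  refine ⟨Nat.le_sub_one_of_lt hl, fun _ => (hdata.change l (hl.trans_le hk)).mem,
    fun m hlm _ hmem => ?_⟩
  exact (mem_filter.1 hmem).2 l hlm rfl

theorem notMem_freeIndices_iff {j : Fin d} : j ∉ freeIndices s k ↔ ∃ l < k, s l = j := by
  simp [freeIndices]

theorem IsDaisyData.toLattice_mem_daisyLayer_iff (hdata : IsDaisyData h q s) (hk : k ≤ h) :
    toLattice x ∈ daisyLayer q s k ↔ InLayer univ z q s k x := by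
  simp only [daisyLayer, toLattice, Set.mem_ofPred_eq]
  constructor
  · intro hx
    refine ⟨fun j hj => by exact_mod_cast (hx j).1 hj, fun l hl => ?_,
      fun j hj => absurd (mem_univ j) hj⟩
    have hremoved := (hx (s l)).2 (notMem_freeIndices_iff.2 ⟨l, hl, rfl⟩)
    rw [hdata.lastFree_eq hk hl] at hremoved
    exact_mod_cast hremoved
  · rintro ⟨hfree, hremoved, -⟩ j
    refine ⟨fun hj => by exact_mod_cast hfree j hj, fun hj => ?_⟩
    obtain ⟨l, hl, rfl⟩ := notMem_freeIndices_iff.1 hj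
    rw [hdata.lastFree_eq hk hl]
    exact_mod_cast hremoved l hl

theorem exists_toLattice_eq_of_mem_daisyLayer {y : Fin d → ℤ} (hy : y ∈ daisyLayer q s k) :
    ∃ x, toLattice x = y := by
  refine ⟨fun j => (y j).toNat, funext fun j => Int.toNat_of_nonneg ?_⟩
  by_cases hj : j ∈ freeIndices s k
  · have := (hy j).1 hj
    omega
  · have := (hy j).2 hj
    omega

theorem IsDaisyData.setOf_mem_daisyLayer_eq (hdata : IsDaisyData h q s) {C : Finset (Fin d → ℕ)}
    (hC : ∀ x, x ∈ C ↔ ∃ k ≤ h, InLayer univ z q s k x) :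
    {y | ∃ k ≤ h, y ∈ daisyLayer q s k} = toLattice '' (C : Set (Fin d → ℕ)) := by
  ext y
  simp only [Set.mem_ofPred_eq, Set.mem_image, mem_coe, hC]
  constructor
  · rintro ⟨k, hk, hy⟩
    obtain ⟨x, rfl⟩ := exists_toLattice_eq_of_mem_daisyLayer hy
    exact ⟨x, ⟨k, hk, (hdata.toLattice_mem_daisyLayer_iff hk).1 hy⟩, rfl⟩
  · rintro ⟨x, ⟨k, hk, hx⟩, rfl⟩
    exact ⟨k, hk, (hdata.toLattice_mem_daisyLayer_iff hk).2 hx⟩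

theorem isDaisy_iff_exists_daisyOn {Q : Set (Fin d → ℤ)} (z : Fin d → ℕ) :
    IsDaisy Q ↔ ∃ c t, ∃ C : Finset (Fin d → ℕ), DaisyOn univ z c t C ∧
      Q = toLattice '' (C : Set (Fin d → ℕ)) := by
  constructor
  · rintro ⟨h, q, s, hdata, rfl⟩
    obtain ⟨c, t, C, hC, -, hmem⟩ := (isDaisyData_iff.1 hdata).exists_daisyOn z
    exact ⟨c, t, C, hC, hdata.setOf_mem_daisyLayer_eq hmem⟩
  · rintro ⟨c, t, C, hC, rfl⟩
    obtain ⟨h, q, s, hdata, -, hmem⟩ := hC.exists_isDaisyDataOn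
    rw [← isDaisyData_iff] at hdata
    exact ⟨h, q, s, hdata, (hdata.setOf_mem_daisyLayer_eq hmem).symm⟩

end Data

/-! ### Daisies as initial segments and minimizers -/

section Main

variable {d : ℕ} {z : Fin d → ℕ} {c : ℕ} {t : Fin d} {C : Finset (Fin d → ℕ)}

theorem encard_image_toLattice (C : Finset (Fin d → ℕ)) :
    (toLattice '' (C : Set (Fin d → ℕ))).encard = #C := by
  rw [toLattice_injective.encard_image, Set.encard_coe_eq_coe_finsetCard]

theorem DaisyOn.isPosTuple {x : Fin d → ℕ} (h : DaisyOn univ z c t C) (hx : x ∈ C) :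
    IsPosTuple x :=
  fun i => ((mem_boxOn.1 (h.subset_boxOn_growTuple hx)).1 i (mem_univ i)).1

theorem DaisyOn.isFirstString (h : DaisyOn univ z c t C) :
    IsFirstString #C (C : Set (Fin d → ℕ)) :=
  ⟨fun _ hx => h.isPosTuple hx, Set.encard_coe_eq_coe_finsetCard C, fun _ hx _ hy hyn =>
    h.precOn hx (fun j _ => hy j) (fun j hj => absurd (mem_univ j) hj) hyn⟩

theorem DaisyOn.isEIPMinimizer (h : DaisyOn univ z c t C) :
    IsEIPMinimizer (toLattice '' (C : Set (Fin d → ℕ))) := by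
  refine ⟨C.finite_toSet.image _, ⟨_, rfl, rfl⟩, ?_⟩
  rintro p ⟨E, hE, rfl⟩
  rw [encard_image_toLattice] at hE
  obtain ⟨E, rfl⟩ := (Set.finite_of_encard_eq_coe hE).exists_finset_coe
  rw [Set.encard_coe_eq_coe_finsetCard, Nat.cast_inj] at hE
  have hshadow : shadowSum univ C ≤ shadowSum univ E :=
    h.shadowSum_le.trans (hE ▸ minShadow_le_shadowSum univ E (by simp [IsConstOff]))
  calc edgePerimeter (toLattice '' (C : Set (Fin d → ℕ)))
      ≤ ((2 * shadowSum univ C : ℕ) : ℕ∞) :=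
        edgePerimeter_toLattice_le (fun _ hx => h.isPosTuple hx)
          fun _ hx i _ => h.update_mem hx (mem_univ i)
    _ ≤ ((2 * shadowSum univ E : ℕ) : ℕ∞) := by exact_mod_cast Nat.mul_le_mul_left 2 hshadow
    _ ≤ edgePerimeter (E : Set (Fin d → ℤ)) := two_mul_shadowSum_le_edgePerimeter E

theorem IsDaisy.exists_isFirstString_and_isEIPMinimizer {Q : Set (Fin d → ℤ)} {n : ℕ}
    (hQ : IsDaisy Q) (hcard : Q.encard = n) :
    (∃ F, IsFirstString n F ∧ Q = toLattice '' F) ∧ IsEIPMinimizer Q := by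
  obtain ⟨c, t, C, hC, rfl⟩ := (isDaisy_iff_exists_daisyOn 0).1 hQ
  rw [encard_image_toLattice, Nat.cast_inj] at hcard
  exact ⟨⟨C, hcard ▸ hC.isFirstString, rfl⟩, hC.isEIPMinimizer⟩

theorem exists_isDaisy_encard_eq (hd : d ≠ 0) {n : ℕ} (hn : n ≠ 0) :
    ∃ Q : Set (Fin d → ℤ), IsDaisy Q ∧ Q.encard = n := by
  have : NeZero d := ⟨hd⟩
  obtain ⟨c, t, C, hC, rfl⟩ := exists_daisyOn_card (univ_nonempty (α := Fin d)) 0 hn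
  exact ⟨_, (isDaisy_iff_exists_daisyOn 0).2 ⟨c, t, C, hC, rfl⟩, encard_image_toLattice C⟩

theorem IsDaisy.eq_of_encard_eq {Q Q' : Set (Fin d → ℤ)} {n : ℕ} (hQ : IsDaisy Q)
    (hQ' : IsDaisy Q') (hcard : Q.encard = n) (hcard' : Q'.encard = n) : Q = Q' := by
  obtain ⟨⟨F, hF, rfl⟩, -⟩ := hQ.exists_isFirstString_and_isEIPMinimizer hcard
  obtain ⟨⟨F', hF', rfl⟩, -⟩ := hQ'.exists_isFirstString_and_isEIPMinimizer hcard'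
  rw [hF.unique hF']

end Main

theorem theorem2p2 (n d : ℕ) (hn : 1 ≤ n) (hd : 1 ≤ d) :
    (∃! Q : Set (Fin d → ℤ), IsDaisy Q ∧ Q.encard = n) ∧
    ∀ Q : Set (Fin d → ℤ), IsDaisy Q → Q.encard = n →
      (∃ F : Set (Fin d → ℕ), IsFirstString n F ∧ Q = toLattice '' F) ∧
      IsEIPMinimizer Q := by
  obtain ⟨Q, hQ, hcard⟩ := exists_isDaisy_encard_eq (Nat.one_le_iff_ne_zero.1 hd)
    (Nat.one_le_iff_ne_zero.1 hn)
  refine ⟨⟨Q, ⟨hQ, hcard⟩, ?_⟩, fun Q' hQ' hcard' =>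
    hQ'.exists_isFirstString_and_isEIPMinimizer hcard'⟩
  rintro Q' ⟨hQ', hcard'⟩
  exact hQ'.eq_of_encard_eq hQ hcard' hcard
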